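/- Let $m\ge 0$, $n=2^m$, $N=2n$, $k\ge 1$ be integers and $\varepsilon = 1/(28k^2\ln N)$. Let $H_n$ be the normalized (Walsh–)Hadamard matrix of order $n$, with entries $n^{-1/2}(-1)^{\langle a,b\rangle}$ for $a,b\in\{0,1\}^m$, and put $\Sigma=\begin{pmatrix} I_n & H_n\\ H_n& I_n\end{pmatrix}$. Distributions. Let $X^{(1)},\dots,X^{(k)}$ be independent $N$-dimensional Brownian motions (started at $0$, mean $0$) with covariance matrix $\Sigma$, and let $\tau_i=\min\{\varepsilon,\ \text{first time that } X^{(i)} \text{ exits } [-1/2,1/2]^N\}$. For $S\subseteq[k]$ let $D_S$ be the distribution on $(\mathbb R^N)^k$ of the random vector whose $i$-th block is $X^{(i)}_{\tau_i}$ if $i\in S$ and $0$ if $i\notin S$. Let $D_{\mathrm{even}}$ (resp. $D_{\mathrm{odd}}$) be the distribution of a draw from $D_S$ with $S$ a uniformly random subset of $[k]$ conditioned on $|S|$ being even (resp. odd). Let $\widetilde D_{\mathrm{even}}$, $\widetilde D_{\mathrm{odd}}$ be the distributions on $\{-1,1\}^{kN}$ obtained by drawing $z$ from $D_{\mathrm{even}}$,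 $D_{\mathrm{odd}}$ and then, independently for each coordinate $j$, setting $\widetilde z_j=1$ with probability $(1+z_j)/2$ and $\widetilde z_j=-1$ with probability $(1-z_j)/2$. Function. Let $\phi(x,y)=\frac1n\langle x,H_ny\rangle$. Let $F$ be the partial function on $\{-1,1\}^n\times\{-1,1\}^n=\{-1,1\}^N$ with $F(x,y)=-1$ if $\phi(x,y)\ge\varepsilon/2$, $F(x,y)=1$ if $\phi(x,y)\le\varepsilon/4$, and $F(x,y)$ undefined otherwise. Let $F^{(k)}(z_1,\dots,z_k)=\prod_{i=1}^kF(z_i)$, which is defined when all the factors are. Claim. There are absolute constants $c,C>0$ such that for all $k\ge1$ and $N=2^{m+1}$, $m\ge 0$, with $k$ small enough that $k^6(\ln N)^3\le cN$ (equivalently, up to the value of $c$, $k^2\ln N\le c\,\varepsilon^2N$), $$\Pr_{\widetilde z\sim\widetilde D_{\mathrm{even}}}\big[F^{(k)}(\widetilde z)=1\big]\ \ge\ 1-\frac{C\,k}{N^{6k^2}}\qquad\text{and}\qquad \Pr_{\widetilde z\sim\widetilde D_{\mathrm{odd}}}\big[F^{(k)}(\widetilde z)=-1\big]\ \ge\ 1-\frac{C\,k}{N^{6k^2}},$$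 where the events include that $F^{(k)}(\widetilde z)$ is defined. -/

import Mathlib

open MeasureTheory ProbabilityTheory
open scoped NNReal ENNReal Matrix

namespace Forrelation

noncomputable section

/-- The index set `{0,1}^m` of the coordinates of `ℝⁿ`, where `n = 2 ^ m`. -/
abbrev Idx (m : ℕ) : Type := Fin m → Bool

/-- The `N = 2n` coordinates of one block `(x, y) ∈ ℝⁿ × ℝⁿ`. -/
abbrev Coord (m : ℕ) : Type := Idx m ⊕ Idx m

/-- `N = 2n = 2 * 2 ^ m`. -/
def blockSize (m : ℕ) : ℕ := 2 * 2 ^ m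

/-- The normalized (Walsh-)Hadamard matrix `H_n`, `n = 2 ^ m`, with entries
`n^{-1/2} (-1)^{⟨a, b⟩}`. -/
def hadamard (m : ℕ) : Matrix (Idx m) (Idx m) ℝ :=
  Matrix.of fun a b => (√((2 : ℝ) ^ m))⁻¹ * ∏ i, (if a i && b i then (-1 : ℝ) else 1)

/-- The covariance matrix `[[I, H], [H, I]]`. -/
def covarianceMatrix (m : ℕ) : Matrix (Coord m) (Coord m) ℝ :=
  Matrix.fromBlocks 1 (hadamard m) (hadamard m) 1

/-- `ε = 1 / (28 k² ln N)`. -/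
def eps (k m : ℕ) : ℝ := 1 / (28 * (k : ℝ) ^ 2 * Real.log (blockSize m))

/-- `φ(x, y) = (1/n) ⟨x, H y⟩`. -/
def phi (m : ℕ) (x y : Idx m → ℝ) : ℝ := 1 / (2 : ℝ) ^ m * (x ⬝ᵥ (hadamard m *ᵥ y))

open Classical in
/-- The Forrelation decision problem with parameter `e`, a partial function: `-1` if
`φ(x, y) ≥ e / 2`, `1` if `φ(x, y) ≤ e / 4`, and undefined (`none`) otherwise. The input is
`z = (x, y) ∈ {-1,1}^N`. -/
def forrelation (e : ℝ) {m : ℕ} (z : Coord m → ℤˣ) : Option ℤˣ :=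
  let v : ℝ := phi m (fun a => ((z (Sum.inl a) : ℤ) : ℝ)) (fun a => ((z (Sum.inr a) : ℤ) : ℝ))
  if e / 2 ≤ v then some (-1) else if v ≤ e / 4 then some 1 else none

open Classical in
/-- The `k`-XOR Forrelation function `F^{(k)}(z₁, …, z_k) = ∏ᵢ F(zᵢ)`, with `ε = eps k m`;
it is defined where all the factors are. -/
def xorForrelation {k m : ℕ} (z : Fin k → Coord m → ℤˣ) : Option ℤˣ :=
  if ∀ i, (forrelation (eps k m) (z i)).isSome then
    some (∏ i, (forrelation (eps k m) (z i)).getD 1)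
  else none

/-- `X` is a Brownian motion with mean `0` and covariance matrix `S`: it starts at `0`, has
independent increments with `X t - X s ∼ N(0, (t - s) S)`, and has almost surely continuous
paths. -/
structure IsBrownianMotion {ι Ω : Type*} [Fintype ι] [DecidableEq ι] [MeasurableSpace Ω]
    (S : Matrix ι ι ℝ) (X : ℝ≥0 → Ω → EuclideanSpace ℝ ι) (P : Measure Ω) : Prop where
  zero : ∀ᵐ ω ∂P, X 0 ω = 0
  indep : HasIndepIncrements X P
  law : ∀ s t : ℝ≥0, s ≤ t →
    HasLaw (fun ω => X t ω - X s ω) (multivariateGaussian 0 (((t : ℝ) - (s : ℝ)) • S)) P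
  cont : ∀ᵐ ω ∂P, Continuous fun t => X t ω

/-- The cube `[-1/2, 1/2]^ι`. -/
def box (ι : Type*) : Set (EuclideanSpace ℝ ι) := {x | ∀ i, x i ∈ Set.Icc (-1 / 2 : ℝ) (1 / 2)}

/-- The stopping time `min {e, first time that X exits [-1/2, 1/2]^ι}`. -/
def stopTime {ι Ω : Type*} (e : ℝ≥0) (X : ℝ≥0 → Ω → EuclideanSpace ℝ ι) : Ω → ℝ≥0 :=
  hittingBtwn X (box ι)ᶜ 0 e

/-- The law `D_S` of the random vector whose `i`-th block is the stopped Brownian motion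
`X⁽ⁱ⁾_{τᵢ}` if `i ∈ S`, and `0` if `i ∉ S`. -/
def distOn {k m : ℕ} {Ω : Type*} [MeasurableSpace Ω] (P : Measure Ω)
    (X : Fin k → ℝ≥0 → Ω → EuclideanSpace ℝ (Coord m)) (S : Finset (Fin k)) :
    Measure (Fin k → EuclideanSpace ℝ (Coord m)) :=
  P.map fun ω i => if i ∈ S then X i (stopTime (eps k m).toNNReal (X i) ω) ω else 0

/-- The mixture of the `D_S` over a uniformly random member `S` of the family `A`. -/
def mixture {k m : ℕ} {Ω : Type*} [MeasurableSpace Ω] (P : Measure Ω)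
    (X : Fin k → ℝ≥0 → Ω → EuclideanSpace ℝ (Coord m)) (A : Finset (Finset (Fin k))) :
    Measure (Fin k → EuclideanSpace ℝ (Coord m)) :=
  (A.card : ℝ≥0∞)⁻¹ • ∑ S ∈ A, distOn P X S

/-- `D_even`: the distribution `D_S`, for `S ⊆ [k]` uniform conditioned on `|S|` even. -/
def evenDist {k m : ℕ} {Ω : Type*} [MeasurableSpace Ω] (P : Measure Ω)
    (X : Fin k → ℝ≥0 → Ω → EuclideanSpace ℝ (Coord m)) :
    Measure (Fin k → EuclideanSpace ℝ (Coord m)) :=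
  mixture P X (Finset.univ.filter fun S => Even S.card)

/-- `D_odd`: the distribution `D_S`, for `S ⊆ [k]` uniform conditioned on `|S|` odd. -/
def oddDist {k m : ℕ} {Ω : Type*} [MeasurableSpace Ω] (P : Measure Ω)
    (X : Fin k → ℝ≥0 → Ω → EuclideanSpace ℝ (Coord m)) :
    Measure (Fin k → EuclideanSpace ℝ (Coord m)) :=
  mixture P X (Finset.univ.filter fun S => Odd S.card)

instance : MeasurableSingletonClass ℤˣ :=
  ⟨fun a => ⟨{(a : ℤ)}, trivial, by ext; simp [Units.ext_iff]⟩⟩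

/-- Rounding of one number `z ∈ [-1, 1]`: the value `1` with probability `(1 + z) / 2` and `-1`
with probability `(1 - z) / 2`. (Outside `[-1, 1]` the probability is truncated to `[0, 1]`.) -/
def roundCoord (z : ℝ) : Measure ℤˣ :=
  bernoulliMeasure 1 (-1) (Set.projIcc (0 : ℝ) 1 zero_le_one ((1 + z) / 2))

instance (z : ℝ) : IsProbabilityMeasure (roundCoord z) := by
  unfold roundCoord; infer_instance

theorem measurable_roundCoord : Measurable roundCoord := by
  refine Measure.measurable_of_measurable_coe _ fun s _ => ?_
  have h : Continuous fun z : ℝ => Set.projIcc (0 : ℝ) 1 zero_le_one ((1 + z) / 2) :=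
    continuous_projIcc.comp (by fun_prop)
  have h1 : Measurable fun z : ℝ =>
      unitInterval.toNNReal (Set.projIcc (0 : ℝ) 1 zero_le_one ((1 + z) / 2)) :=
    (unitInterval.toNNReal_continuous.comp h).measurable
  have h2 : Measurable fun z : ℝ => unitInterval.toNNReal
      (unitInterval.symm (Set.projIcc (0 : ℝ) 1 zero_le_one ((1 + z) / 2))) :=
    (unitInterval.toNNReal_continuous.comp (unitInterval.continuous_symm.comp h)).measurable
  simp only [roundCoord, bernoulliMeasure_def, Measure.add_apply, Measure.smul_apply]
  exact (h1.coe_nnreal_ennreal.mul_const _).add (h2.coe_nnreal_ennreal.mul_const _)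

theorem measurable_pi_measure {ι α : Type*} [Fintype ι] [MeasurableSpace α] {β : ι → Type*}
    [∀ i, MeasurableSpace (β i)] (μ : α → ∀ i, Measure (β i))
    [∀ a i, IsProbabilityMeasure (μ a i)] (h : ∀ i, Measurable fun a => μ a i) :
    Measurable fun a => Measure.pi (μ a) := by
  refine Measurable.measure_of_isPiSystem_of_isProbabilityMeasure generateFrom_pi.symm
    isPiSystem_pi ?_
  rintro _ ⟨s, hs, rfl⟩
  simp only [Measure.pi_pi]
  exact Finset.measurable_prod _ fun i _ =>
    (Measure.measurable_coe (hs i (Set.mem_univ i))).comp (h i)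

/-- The rounding step: each coordinate of `z` is rounded independently by `roundCoord`. -/
def rounding (k m : ℕ) :
    Kernel (Fin k → EuclideanSpace ℝ (Coord m)) (Fin k → Coord m → ℤˣ) where
  toFun z := Measure.pi fun i => Measure.pi fun j => roundCoord (z i j)
  measurable' := by
    refine measurable_pi_measure _ fun i => measurable_pi_measure _ fun j => ?_
    exact measurable_roundCoord.comp (by fun_prop)

/-- The rounded distribution on `{-1,1}^{kN}` obtained from `D_even`. -/
def roundedEven {k m : ℕ} {Ω : Type*} [MeasurableSpace Ω] (P : Measure Ω)
    (X : Fin k → ℝ≥0 → Ω → EuclideanSpace ℝ (Coord m)) : Measure (Fin k → Coord m → ℤˣ) :=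
  (evenDist P X).bind (rounding k m)

/-- The rounded distribution on `{-1,1}^{kN}` obtained from `D_odd`. -/
def roundedOdd {k m : ℕ} {Ω : Type*} [MeasurableSpace Ω] (P : Measure Ω)
    (X : Fin k → ℝ≥0 → Ω → EuclideanSpace ℝ (Coord m)) : Measure (Fin k → Coord m → ℤˣ) :=
  (oddDist P X).bind (rounding k m)

end

end Forrelation

namespace Forrelation

/-! The covariance is degenerate: since `H` is symmetric with `H² = 1`, the Brownian motion
satisfies `y_t = H x_t` for all `t`, so `φ(x_t, y_t) = |x_t|² / n`, an average of `n` independent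
squares with mean `t`. An exponential submartingale and Doob's inequality keep it above `t - d` for
all `t ≤ ε` at once (`measure_exists_meanSq_lt_le`), so it can be evaluated at the random time `τ`.
No coordinate leaves `[-1/2, 1/2]` before `t₀ = ε/2 + 2d` except with probability about `N
exp(-1/(8t₀))` (`measure_exists_half_lt_abs_le`), so `φ ≥ t₀ - d` at time `τ`. Rounding moves `φ` by
at least `d` only with probability `4 exp(-d² n / 8)` (`measureReal_rounding_phi_le`). Thus a moving
block ends with `φ ≥ ε/2`, and a zero block with `φ ≤ d ≤ ε/4`.

As `1/(4ε) = 7 k² ln N`, the exit term is about `N^(1 - 7k²)`, and `d` is chosen so that the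
rounding term is of order `N^(-6k²)` (`exists_blockError_le`). A union bound over the blocks gives
the factor `k`, and when all blocks are correct the product of signs is `(-1)^|S|`. -/

/-! ### Hadamard matrix and covariance. -/

theorem hadamard_transpose (m : ℕ) : (hadamard m)ᵀ = hadamard m := by
  ext a b
  simp only [hadamard, Matrix.transpose_apply, Matrix.of_apply]
  congr 1
  exact Finset.prod_congr rfl fun i _ => by rw [Bool.and_comm]

theorem hadamard_mul_self (m : ℕ) : hadamard m * hadamard m = 1 := by
  ext a c
  simp only [hadamard, Matrix.mul_apply, Matrix.of_apply]
  have h1 : ∀ b : Idx m, ((√((2 : ℝ) ^ m))⁻¹ * ∏ i, (if a i && b i then (-1 : ℝ) else 1)) *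
      ((√((2 : ℝ) ^ m))⁻¹ * ∏ i, (if b i && c i then (-1 : ℝ) else 1)) =
      ((2 : ℝ) ^ m)⁻¹ * ∏ i, ((if a i && b i then (-1 : ℝ) else 1) *
        (if b i && c i then (-1 : ℝ) else 1)) := fun b => by
    rw [Finset.prod_mul_distrib, mul_mul_mul_comm, ← mul_inv, Real.mul_self_sqrt (by positivity)]
  simp_rw [h1]
  -- The sum over `{0,1}^m` factors into `m` two-term sums, each `2` or `0`.
  have h2 := Finset.prod_univ_sum (fun _ : Fin m => (Finset.univ : Finset Bool))
    (fun i β => ((if a i && β then (-1 : ℝ) else 1) * (if β && c i then (-1 : ℝ) else 1)))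
  rw [← Finset.mul_sum]
  rw [Fintype.piFinset_univ] at h2
  rw [← h2]
  have h3 : ∀ i, (∑ β : Bool, ((if a i && β then (-1 : ℝ) else 1) *
      (if β && c i then (-1 : ℝ) else 1))) = if a i = c i then 2 else 0 := fun i => by
    cases a i <;> cases c i <;> norm_num
  simp_rw [h3, Matrix.one_apply, funext_iff]
  by_cases h : ∀ i, a i = c i
  · simp [h]
  · rw [if_neg h]
    push Not at h
    obtain ⟨i, hi⟩ := h
    rw [Finset.prod_eq_zero (Finset.mem_univ i) (by simp [hi]), mul_zero]

theorem hadamard_mulVec_mulVec (m : ℕ) (x : Idx m → ℝ) : hadamard m *ᵥ (hadamard m *ᵥ x) = x := by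
  rw [Matrix.mulVec_mulVec, hadamard_mul_self, Matrix.one_mulVec]

theorem hadamard_dotProduct (m : ℕ) (x y : Idx m → ℝ) :
    (hadamard m *ᵥ x) ⬝ᵥ y = x ⬝ᵥ (hadamard m *ᵥ y) := by
  rw [Matrix.dotProduct_mulVec, ← Matrix.mulVec_transpose, hadamard_transpose]

theorem hadamard_dotProduct_self (m : ℕ) (x : Idx m → ℝ) :
    (hadamard m *ᵥ x) ⬝ᵥ (hadamard m *ᵥ x) = x ⬝ᵥ x := by
  rw [hadamard_dotProduct, hadamard_mulVec_mulVec]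

/-- Because `H² = 1`, the matrix is the Gram matrix `(I H)ᵀ (I H)`; its rank is only `n`. -/
theorem covarianceMatrix_posSemidef (m : ℕ) : (covarianceMatrix m).PosSemidef := by
  have h : covarianceMatrix m =
      (Matrix.fromCols (1 : Matrix (Idx m) (Idx m) ℝ) (hadamard m))ᴴ *
        Matrix.fromCols (1 : Matrix (Idx m) (Idx m) ℝ) (hadamard m) := by
    rw [Matrix.conjTranspose_fromCols_eq_fromRows_conjTranspose, Matrix.fromRows_mul_fromCols]
    simp [covarianceMatrix, Matrix.conjTranspose_eq_transpose_of_trivial, hadamard_transpose,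
      hadamard_mul_self]
  rw [h]
  exact Matrix.posSemidef_conjTranspose_mul_self _

theorem smul_covarianceMatrix_posSemidef (m : ℕ) (t : ℝ≥0) :
    ((t : ℝ) • covarianceMatrix m).PosSemidef :=
  (covarianceMatrix_posSemidef m).smul t.2

theorem covarianceMatrix_diag (m : ℕ) (j : Coord m) : covarianceMatrix m j j = 1 := by
  cases j <;> simp [covarianceMatrix]

/-- `φ(x, Hx) = |x|² / n`. -/
theorem phi_hadamard_mulVec (m : ℕ) (x : Idx m → ℝ) :
    phi m x (hadamard m *ᵥ x) = 1 / (2 : ℝ) ^ m * (x ⬝ᵥ x) := by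
  rw [phi, hadamard_mulVec_mulVec]

/-! ### Concentration of `φ` under rounding. -/

theorem _root_.ProbabilityTheory.HasSubgaussianMGF.mono {Ω : Type*} [MeasurableSpace Ω]
    {μ : Measure Ω} {X : Ω → ℝ} {c d : ℝ≥0} (h : HasSubgaussianMGF X c μ) (hcd : c ≤ d) :
    HasSubgaussianMGF X d μ where
  integrable_exp_mul := h.integrable_exp_mul
  mgf_le t := (h.mgf_le t).trans <| Real.exp_le_exp.2 <| by
    have : (c : ℝ) ≤ d := hcd
    gcongr

theorem integral_roundCoord {z : ℝ} (hz : z ∈ Set.Icc (-1 : ℝ) 1) :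
    ∫ s, ((s : ℤ) : ℝ) ∂(roundCoord z) = z := by
  have h : (1 + z) / 2 ∈ Set.Icc (0 : ℝ) 1 := ⟨by linarith [hz.1], by linarith [hz.2]⟩
  rw [roundCoord, Set.projIcc_of_mem _ h, bernoulliMeasure_def, integral_add_measure,
    integral_smul_nnreal_measure, integral_smul_nnreal_measure, integral_dirac, integral_dirac]
  · simp [NNReal.smul_def]
    ring
  · exact Integrable.of_finite
  · exact Integrable.of_finite

/-- Hoeffding's lemma for a variable in `[-1, 1]`: the variance proxy is `((1 - (-1)) / 2)² = 1`. -/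
theorem hasSubgaussianMGF_roundCoord {z : ℝ} (hz : z ∈ Set.Icc (-1 : ℝ) 1) :
    HasSubgaussianMGF (fun s : ℤˣ => ((s : ℤ) : ℝ) - z) 1 (roundCoord z) := by
  have h := hasSubgaussianMGF_of_mem_Icc (μ := roundCoord z) (X := fun s : ℤˣ => ((s : ℤ) : ℝ))
    (a := -1) (b := 1) (Measurable.of_discrete).aemeasurable (ae_of_all _ fun s => by
      rcases Int.units_eq_one_or s with rfl | rfl <;> simp)
  rw [integral_roundCoord hz] at h
  refine h.mono (le_of_eq ?_)
  ext
  simp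
  norm_num

theorem hasSubgaussianMGF_rounding_linear {ι : Type*} [Fintype ι] {z : ι → ℝ}
    (hz : ∀ i, z i ∈ Set.Icc (-1 : ℝ) 1) (w : ι → ℝ) {V : ℝ≥0} (hV : w ⬝ᵥ w ≤ V) :
    HasSubgaussianMGF (fun s : ι → ℤˣ => w ⬝ᵥ fun i => (((s i : ℤ) : ℝ) - z i)) V
      (Measure.pi fun i => roundCoord (z i)) := by
  have hi : iIndepFun (fun i (s : ι → ℤˣ) => w i * (((s i : ℤ) : ℝ) - z i))
      (Measure.pi fun i => roundCoord (z i)) :=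
    iIndepFun_pi (X := fun i (s : ℤˣ) => w i * (((s : ℤ) : ℝ) - z i))
      fun i => (Measurable.of_discrete).aemeasurable
  have h := HasSubgaussianMGF.sum_of_iIndepFun hi (s := Finset.univ)
    (c := fun i => (w i ^ 2).toNNReal) fun i _ => by
      have h1 := (hasSubgaussianMGF_roundCoord (hz i)).const_mul (w i)
      have h2 := measurePreserving_eval (fun i => roundCoord (z i)) i
      rw [← h2.map_eq] at h1
      refine (HasSubgaussianMGF.of_map (Y := Function.eval i)
        (X := fun t : ℤˣ => w i * (((t : ℤ) : ℝ) - z i)) h2.measurable.aemeasurable h1).mono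
        (le_of_eq ((mul_one (_ : ℝ≥0)).trans (Real.toNNReal_of_nonneg (sq_nonneg _)).symm))
  refine h.mono ?_
  rw [← NNReal.coe_le_coe]
  refine le_trans (le_of_eq ?_) hV
  simp [dotProduct, NNReal.coe_sum, ← sq, sq_nonneg]

theorem measureReal_rounding_linear_le {ι : Type*} [Fintype ι] {z : ι → ℝ}
    (hz : ∀ i, z i ∈ Set.Icc (-1 : ℝ) 1) (w : ι → ℝ) {V d : ℝ} (hV : w ⬝ᵥ w ≤ V) (hd : 0 ≤ d) :
    (Measure.pi fun i => roundCoord (z i)).real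
      {s : ι → ℤˣ | d ≤ |w ⬝ᵥ fun i => (((s i : ℤ) : ℝ) - z i)|} ≤
      2 * Real.exp (-d ^ 2 / (2 * V)) := by
  have hV0 : 0 ≤ V := le_trans (Finset.sum_nonneg fun i _ => mul_self_nonneg _) hV
  lift V to ℝ≥0 using hV0
  have h := hasSubgaussianMGF_rounding_linear hz w hV
  have h1 := h.measure_ge_le hd
  have h2 := h.neg.measure_ge_le hd
  rw [two_mul]
  refine le_trans (measureReal_mono ?_) ((measureReal_union_le _ _).trans (add_le_add h1 h2))
  intro s hs
  exact le_abs.1 (Set.mem_ofPred_eq ▸ hs)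


/-- The `±1` vector `s`, as a real vector. -/
def signVec {ι : Type*} (s : ι → ℤˣ) : ι → ℝ := fun i => ((s i : ℤ) : ℝ)

theorem signVec_dotProduct_self {ι : Type*} [Fintype ι] (s : ι → ℤˣ) :
    signVec s ⬝ᵥ signVec s = Fintype.card ι := by
  have h : ∀ i, signVec s i * signVec s i = 1 := fun i => by
    rcases Int.units_eq_one_or (s i) with h | h <;> simp [signVec, h]
  simp [dotProduct, h]

theorem dotProduct_self_le_card {ι : Type*} [Fintype ι] {x : ι → ℝ}
    (hx : ∀ i, x i ∈ Set.Icc (-1 : ℝ) 1) : x ⬝ᵥ x ≤ Fintype.card ι := by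
  have h : ∀ i ∈ Finset.univ, x i * x i ≤ 1 := fun i _ => by nlinarith [(hx i).1, (hx i).2]
  simpa [dotProduct] using Finset.sum_le_sum h

theorem phi_sub_left (m : ℕ) (x x' y : Idx m → ℝ) :
    phi m x y - phi m x' y = ((1 / (2 : ℝ) ^ m) • hadamard m *ᵥ y) ⬝ᵥ (x - x') := by
  rw [phi, phi, ← mul_sub, ← sub_dotProduct, smul_dotProduct, dotProduct_comm, smul_eq_mul]

theorem phi_sub_right (m : ℕ) (x y y' : Idx m → ℝ) :
    phi m x y - phi m x y' = ((1 / (2 : ℝ) ^ m) • hadamard m *ᵥ x) ⬝ᵥ (y - y') := by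
  rw [phi, phi, ← mul_sub, ← dotProduct_sub, ← Matrix.mulVec_sub, ← hadamard_dotProduct,
    smul_dotProduct, smul_eq_mul]

/-- `H` is an isometry, so the bound is `n / n²`. It is the variance proxy of `φ` in one argument
with the other fixed. -/
theorem smul_hadamard_dotProduct_self_le (m : ℕ) {x : Idx m → ℝ} (hx : x ⬝ᵥ x ≤ 2 ^ m) :
    ((1 / (2 : ℝ) ^ m) • hadamard m *ᵥ x) ⬝ᵥ ((1 / (2 : ℝ) ^ m) • hadamard m *ᵥ x) ≤
      1 / 2 ^ m := by
  rw [smul_dotProduct, dotProduct_smul, hadamard_dotProduct_self, smul_eq_mul, smul_eq_mul]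
  calc _ ≤ 1 / (2 : ℝ) ^ m * (1 / 2 ^ m * 2 ^ m) := by gcongr
    _ = 1 / 2 ^ m := by field_simp

/-- Concentration of `φ` under rounding. -/
theorem measureReal_rounding_phi_le (m : ℕ) {z : Coord m → ℝ}
    (hz : ∀ j, z j ∈ Set.Icc (-1 : ℝ) 1) {d : ℝ} (hd : 0 ≤ d) :
    (Measure.pi fun j => roundCoord (z j)).real {s : Coord m → ℤˣ |
      d ≤ |phi m (signVec fun a => s (Sum.inl a)) (signVec fun a => s (Sum.inr a)) -
        phi m (fun a => z (Sum.inl a)) (fun a => z (Sum.inr a))|} ≤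
      4 * Real.exp (-(d ^ 2 * 2 ^ m / 8)) := by
  set x : Idx m → ℝ := fun a => z (Sum.inl a)
  set y : Idx m → ℝ := fun a => z (Sum.inr a)
  set μ := Measure.pi fun a => roundCoord (x a)
  set ν := Measure.pi fun a => roundCoord (y a)
  have hx : ∀ a, x a ∈ Set.Icc (-1 : ℝ) 1 := fun a => hz _
  have hy : ∀ a, y a ∈ Set.Icc (-1 : ℝ) 1 := fun a => hz _
  have hcard : (Fintype.card (Idx m) : ℝ) = 2 ^ m := by simp
  have hexp : -(d / 2) ^ 2 / (2 * (1 / 2 ^ m)) = -(d ^ 2 * 2 ^ m / 8) := by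
    field_simp
    ring
  have hmp := measurePreserving_sumPiEquivProdPi (fun j => roundCoord (z j))
  -- The bilinear form is linear in each half: `A` rounds `x` with the rounded `y` held fixed, `B`
  -- then rounds `y` with `x` unrounded. Each stage is allowed `d / 2`.
  let A : Set ((Idx m → ℤˣ) × (Idx m → ℤˣ)) :=
    {p | d / 2 ≤ |phi m (signVec p.1) (signVec p.2) - phi m x (signVec p.2)|}
  let B : Set (Idx m → ℤˣ) := {t | d / 2 ≤ |phi m x (signVec t) - phi m x y|}
  have hA : (μ.prod ν) A ≤ ENNReal.ofReal (2 * Real.exp (-(d ^ 2 * 2 ^ m / 8))) := by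
    rw [Measure.prod_apply_symm (Set.toFinite A).measurableSet]
    calc _ ≤ ∫⁻ _, ENNReal.ofReal (2 * Real.exp (-(d ^ 2 * 2 ^ m / 8))) ∂ν := by
          refine lintegral_mono fun t => ?_
          rw [ENNReal.le_ofReal_iff_toReal_le (by finiteness) (by positivity), ← hexp]
          refine le_trans (le_of_eq ?_) (measureReal_rounding_linear_le hx _
            (smul_hadamard_dotProduct_self_le m (x := signVec t)
              (by rw [signVec_dotProduct_self, hcard])) (by positivity))
          rw [Measure.real]
          congr 2
          ext s
          simp only [A, Set.mem_preimage, Set.mem_ofPred_eq, phi_sub_left]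
          rfl
      _ = _ := by simp
  have hB : ν B ≤ ENNReal.ofReal (2 * Real.exp (-(d ^ 2 * 2 ^ m / 8))) := by
    rw [ENNReal.le_ofReal_iff_toReal_le (by finiteness) (by positivity), ← hexp]
    refine le_trans (le_of_eq ?_) (measureReal_rounding_linear_le hy _
      (smul_hadamard_dotProduct_self_le m (x := x)
        ((dotProduct_self_le_card hx).trans_eq hcard)) (by positivity))
    rw [Measure.real]
    congr 2
    ext s
    simp only [B, Set.mem_ofPred_eq, phi_sub_right]
    rfl
  have hsub : {s : Coord m → ℤˣ | d ≤ |phi m (signVec fun a => s (Sum.inl a))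
      (signVec fun a => s (Sum.inr a)) - phi m x y|} ⊆
      (MeasurableEquiv.sumPiEquivProdPi fun _ => ℤˣ) ⁻¹' (A ∪ Prod.snd ⁻¹' B) := by
    intro s hs
    by_contra hcon
    simp only [Set.mem_preimage, Set.mem_union, not_or, A, B, Set.mem_ofPred_eq, not_le] at hcon hs
    have h1 : |phi m (signVec fun a => s (Sum.inl a)) (signVec fun a => s (Sum.inr a)) -
      phi m x (signVec fun a => s (Sum.inr a))| < d / 2 := hcon.1
    have h2 : |phi m x (signVec fun a => s (Sum.inr a)) - phi m x y| < d / 2 := hcon.2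
    have h3 := abs_sub_le (phi m (signVec fun a => s (Sum.inl a))
      (signVec fun a => s (Sum.inr a))) (phi m x (signVec fun a => s (Sum.inr a))) (phi m x y)
    linarith
  rw [Measure.real, ← ENNReal.le_ofReal_iff_toReal_le (by finiteness) (by positivity)]
  refine (measure_mono hsub).trans ?_
  rw [hmp.measure_preimage (Set.toFinite _).measurableSet.nullMeasurableSet]
  refine (measure_union_le _ _).trans ?_
  rw [← Set.univ_prod, Measure.prod_prod, measure_univ, one_mul]
  refine (add_le_add hA hB).trans ?_
  rw [← ENNReal.ofReal_add (by positivity) (by positivity)]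
  exact ENNReal.ofReal_le_ofReal (by linarith)

/-! ### Maximal inequality for random walks. -/

theorem lintegral_pi_succ {E : Type*} [MeasurableSpace E] {μ : Measure E}
    [IsProbabilityMeasure μ] {n : ℕ} {f : E × (Fin n → E) → ℝ≥0∞} (hf : Measurable f) :
    ∫⁻ w, f (w 0, fun i => w i.succ) ∂(Measure.pi fun _ : Fin (n + 1) => μ) =
      ∫⁻ v, ∫⁻ w, f (v, w) ∂(Measure.pi fun _ : Fin n => μ) ∂μ := by
  have h := measurePreserving_piFinSuccAbove (fun _ : Fin (n + 1) => μ) 0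
  rw [← lintegral_prod f hf.aemeasurable, ← h.lintegral_comp hf]
  rfl

section RandomWalk

variable {E : Type*} [AddCommMonoid E]

/-- The `j`-th partial sum of a finite sequence. -/
def partialSum {n : ℕ} (w : Fin n → E) (j : ℕ) : E := ∑ i : Fin n, if (i : ℕ) < j then w i else 0

theorem partialSum_zero {n : ℕ} (w : Fin n → E) : partialSum w 0 = 0 := by simp [partialSum]

theorem partialSum_length {n : ℕ} (w : Fin n → E) : partialSum w n = ∑ i, w i := by
  simp [partialSum]

theorem partialSum_succ {n : ℕ} (w : Fin (n + 1) → E) (j : ℕ) :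
    partialSum w (j + 1) = w 0 + partialSum (fun i => w i.succ) j := by
  simp [partialSum, Fin.sum_univ_succ]

variable [MeasurableSpace E] [MeasurableAdd₂ E]

theorem measurable_partialSum {n : ℕ} (j : ℕ) :
    Measurable fun w : Fin n → E => partialSum w j := by
  unfold partialSum
  refine Finset.measurable_sum _ fun i _ => ?_
  split_ifs <;> fun_prop

variable {μ : Measure E} [IsProbabilityMeasure μ]

/-- Conditioning on the first step iterates the one-step submartingale inequality. The time
dependence of `f` lets the induction shift it to `f (j + 1)`. -/
theorem le_lintegral_walk (n : ℕ) : ∀ {f : ℕ → E → ℝ≥0∞} (_ : ∀ j, Measurable (f j))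
    (_ : ∀ j x, f j x ≤ ∫⁻ w, f (j + 1) (x + w) ∂μ) (x : E),
    f 0 x ≤ ∫⁻ w, f n (x + ∑ i, w i) ∂(Measure.pi fun _ : Fin n => μ) := by
  induction n with
  | zero => intro f _ _ x; simp
  | succ n ih =>
    intro f hm hf x
    have h1 : ∀ w : Fin (n + 1) → E, f (n + 1) (x + ∑ i, w i) =
        f (n + 1) (x + w 0 + ∑ i : Fin n, w i.succ) :=
      fun w => by rw [Fin.sum_univ_succ, add_assoc]
    simp_rw [h1]
    rw [lintegral_pi_succ (f := fun p => f (n + 1) (x + p.1 + ∑ i : Fin n, p.2 i))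
      ((hm _).comp (by fun_prop))]
    exact (hf 0 x).trans (lintegral_mono fun v =>
      ih (f := fun j => f (j + 1)) (fun j => hm _) (fun j => hf _) (x + v))

/-- **Doob's maximal inequality** along a random walk. -/
theorem mul_measure_exists_le_lintegral_walk (a : ℝ≥0∞) (n : ℕ) :
    ∀ {f : ℕ → E → ℝ≥0∞} (_ : ∀ j, Measurable (f j))
    (_ : ∀ j x, f j x ≤ ∫⁻ w, f (j + 1) (x + w) ∂μ) (x : E),
    a * (Measure.pi fun _ : Fin n => μ) {w | ∃ j ≤ n, a ≤ f j (x + partialSum w j)} ≤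
      ∫⁻ w, f n (x + ∑ i, w i) ∂(Measure.pi fun _ : Fin n => μ) := by
  induction n with
  | zero =>
    intro f hm hf x
    by_cases h : a ≤ f 0 x
    · simp [partialSum, h]
    · simp [partialSum, h]
  | succ n ih =>
    intro f hm hf x
    -- If the level is reached at time `0`, the submartingale inequality suffices; otherwise it is
    -- reached after the first step, and the induction hypothesis applies from `x + v`.
    by_cases h : a ≤ f 0 x
    · calc _ ≤ a * 1 := by gcongr; exact prob_le_one
        _ ≤ f 0 x := by rwa [mul_one]
        _ ≤ _ := le_lintegral_walk (n + 1) hm hf x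
    have h1 : ∀ w : Fin (n + 1) → E, f (n + 1) (x + ∑ i, w i) =
        f (n + 1) (x + w 0 + ∑ i : Fin n, w i.succ) :=
      fun w => by rw [Fin.sum_univ_succ, add_assoc]
    simp_rw [h1]
    rw [lintegral_pi_succ (f := fun p => f (n + 1) (x + p.1 + ∑ i : Fin n, p.2 i))
      ((hm _).comp (by fun_prop))]
    let S : Set (E × (Fin n → E)) :=
      {p | ∃ j ≤ n, a ≤ f (j + 1) (x + p.1 + partialSum p.2 j)}
    have hS : MeasurableSet S := by
      have : S = ⋃ j ∈ Set.Iic n, {p | a ≤ f (j + 1) (x + p.1 + partialSum p.2 j)} := by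
        ext p
        simp [S]
      rw [this]
      refine MeasurableSet.biUnion (Set.to_countable _) fun j _ => measurableSet_le
        measurable_const ((hm _).comp ?_)
      exact (measurable_const.add measurable_fst).add
        ((measurable_partialSum j).comp measurable_snd)
    have h2 : {w : Fin (n + 1) → E | ∃ j ≤ n + 1, a ≤ f j (x + partialSum w j)} =
        (MeasurableEquiv.piFinSuccAbove (fun _ => E) 0) ⁻¹' S := by
      ext w
      constructor
      · rintro ⟨j, hj, hw⟩
        cases j with
        | zero => exact absurd (by simpa [partialSum_zero] using hw) h
        | succ j =>
          refine ⟨j, by omega, ?_⟩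
          rw [partialSum_succ, ← add_assoc] at hw
          exact hw
      · rintro ⟨j, hj, hw⟩
        refine ⟨j + 1, by omega, ?_⟩
        rw [partialSum_succ, ← add_assoc]
        exact hw
    rw [h2, (measurePreserving_piFinSuccAbove (fun _ : Fin (n + 1) => μ) 0).measure_preimage
      hS.nullMeasurableSet, Measure.prod_apply hS,
      ← lintegral_const_mul _ (measurable_measure_prodMk_left hS)]
    exact lintegral_mono fun v =>
      ih (f := fun j => f (j + 1)) (fun j => hm _) (fun j => hf _) (x + v)

end RandomWalk

/-! ### Maximal inequality for Brownian motion. -/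

/-- On a grid of mesh `h` the increments are independent with the same Gaussian law, so the path is
a random walk and the discrete inequality applies. -/
theorem IsBrownianMotion.measure_grid_le {ι Ω : Type*} [Fintype ι] [DecidableEq ι]
    [MeasurableSpace Ω] {S : Matrix ι ι ℝ} {X : ℝ≥0 → Ω → EuclideanSpace ℝ ι} {P : Measure Ω}
    [IsProbabilityMeasure P] (hX : IsBrownianMotion S X P)
    {g : ℝ≥0 → EuclideanSpace ℝ ι → ℝ≥0∞} (hg : ∀ t, Measurable (g t))
    (hsub : ∀ t (h : ℝ≥0) x, g t x ≤ ∫⁻ w, g (t + h) (x + w) ∂(multivariateGaussian 0 ((h : ℝ) • S)))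
    (a : ℝ≥0∞) (h : ℝ≥0) (n : ℕ) :
    a * P {ω | ∃ j ≤ n, a ≤ g (j * h) (X (j * h) ω)} ≤
      ∫⁻ w, g (n * h) w ∂(multivariateGaussian 0 (((n * h : ℝ≥0) : ℝ) • S)) := by
  set γ := multivariateGaussian 0 ((h : ℝ) • S)
  have hmono : Monotone fun j : Fin (n + 1) => ((j : ℕ) : ℝ≥0) * h := fun i j hij => by
    dsimp only
    gcongr
    exact hij
  have hlaw : HasLaw (fun ω (i : Fin n) => X (((i : ℕ) + 1 : ℝ≥0) * h) ω - X ((i : ℕ) * h) ω)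
      (Measure.pi fun _ => γ) P := by
    refine iIndepFun.hasLaw_pi (fun i => ?_) ?_
    · convert hX.law ((i : ℕ) * h) (((i : ℕ) + 1 : ℝ≥0) * h) (by gcongr; simp) using 3
      push_cast
      ring
    · simpa using hX.indep n _ hmono
  have htel : ∀ ω, X 0 ω = 0 → ∀ j ≤ n, X (j * h) ω =
      partialSum (fun i : Fin n => X (((i : ℕ) + 1 : ℝ≥0) * h) ω - X ((i : ℕ) * h) ω) j := by
    intro ω h0 j hj
    induction j with
    | zero => simp [h0, partialSum_zero]
    | succ j ih =>
      have h1 : ∀ w : Fin n → EuclideanSpace ℝ ι,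
          partialSum w (j + 1) = partialSum w j + w ⟨j, hj⟩ := fun w => by
        have : ∀ i : Fin n, (if (i : ℕ) < j + 1 then w i else 0) =
            (if (i : ℕ) < j then w i else 0) + if i = ⟨j, hj⟩ then w i else 0 := fun i => by
          rcases lt_trichotomy (i : ℕ) j with h | h | h
          · simp [h, h.trans (Nat.lt_succ_self j), Fin.ext_iff, h.ne]
          · simp [h, Fin.ext_iff]
          · simp [h.not_gt, Fin.ext_iff, h.ne', Nat.not_lt.2 (Nat.succ_le_of_lt h)]
        simp_rw [partialSum, this, Finset.sum_add_distrib]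
        simp
      rw [h1, ← ih (by omega)]
      push_cast
      abel
  have hset : P {ω | ∃ j ≤ n, a ≤ g (j * h) (X (j * h) ω)} =
      (Measure.pi fun _ : Fin n => γ) {w | ∃ j ≤ n, a ≤ g (j * h) (0 + partialSum w j)} := by
    rw [← hlaw.map_eq, Measure.map_apply_of_aemeasurable hlaw.aemeasurable]
    · refine measure_congr ?_
      filter_upwards [hX.zero] with ω h0
      refine propext ⟨?_, ?_⟩
      · rintro ⟨j, hj, hw⟩
        exact ⟨j, hj, by rwa [zero_add, ← htel ω h0 j hj]⟩
      · rintro ⟨j, hj, hw⟩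
        exact ⟨j, hj, by rwa [zero_add, ← htel ω h0 j hj] at hw⟩
    · have : {w : Fin n → EuclideanSpace ℝ ι | ∃ j ≤ n, a ≤ g (j * h) (0 + partialSum w j)} =
          ⋃ j ∈ Set.Iic n, {w | a ≤ g (j * h) (0 + partialSum w j)} := by
        ext p
        simp
      rw [this]
      exact MeasurableSet.biUnion (Set.to_countable _) fun j _ => measurableSet_le
        measurable_const ((hg _).comp (measurable_const.add (measurable_partialSum j)))
  have hend : ∫⁻ w, g (n * h) w ∂(multivariateGaussian 0 (((n * h : ℝ≥0) : ℝ) • S)) =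
      ∫⁻ w, g (n * h) (0 + ∑ i, w i) ∂(Measure.pi fun _ : Fin n => γ) := by
    have h1 := hX.law 0 (n * h) zero_le
    rw [NNReal.coe_zero, sub_zero] at h1
    rw [← h1.lintegral_comp (hg _).aemeasurable, ← hlaw.lintegral_comp
      (f := fun w => g (n * h) (0 + ∑ i, w i)) ((hg _).comp (by fun_prop)).aemeasurable]
    refine lintegral_congr_ae ?_
    filter_upwards [hX.zero] with ω h0
    rw [zero_add, ← partialSum_length, ← htel ω h0 n le_rfl, h0, sub_zero]
  rw [hset, hend]
  refine mul_measure_exists_le_lintegral_walk a n (f := fun j => g (j * h)) (fun j => hg _)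
    (fun j x => ?_) 0
  have h1 := hsub (j * h) h x
  convert h1 using 4
  push_cast
  ring

/-- **Doob's maximal inequality** for Brownian motion: `g (t, X t)` is a submartingale. -/
theorem IsBrownianMotion.measure_exists_lt_le {ι Ω : Type*} [Fintype ι] [DecidableEq ι]
    [MeasurableSpace Ω] {S : Matrix ι ι ℝ} {X : ℝ≥0 → Ω → EuclideanSpace ℝ ι} {P : Measure Ω}
    [IsProbabilityMeasure P] (hX : IsBrownianMotion S X P)
    {g : ℝ≥0 → EuclideanSpace ℝ ι → ℝ≥0∞} (hg : Continuous fun p : ℝ≥0 × _ => g p.1 p.2)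
    (hsub : ∀ t (h : ℝ≥0) x, g t x ≤ ∫⁻ w, g (t + h) (x + w) ∂(multivariateGaussian 0 ((h : ℝ) • S)))
    (a : ℝ≥0∞) (T : ℝ≥0) :
    a * P {ω | ∃ t ≤ T, a < g t (X t ω)} ≤
      ∫⁻ w, g T w ∂(multivariateGaussian 0 ((T : ℝ) • S)) := by
  -- Dyadic grids are nested, so these events increase and the uniform bound passes to their union.
  let A : ℕ → Set Ω := fun K => {ω | 
    ∃ j : ℕ, j ≤ 2 ^ K ∧ a ≤ g (j * (T / 2 ^ K)) (X (j * (T / 2 ^ K)) ω)}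
  have hA : Monotone A := monotone_nat_of_le_succ fun K ω => by
    rintro ⟨j, hj, h⟩
    have h1 : ((2 * j : ℕ) : ℝ≥0) * (T / 2 ^ (K + 1)) = j * (T / 2 ^ K) := by
      rw [pow_succ]
      push_cast
      field_simp
    exact ⟨2 * j, by rw [pow_succ]; omega, by rwa [h1]⟩
  have hgt : ∀ t, Measurable (g t) := fun t => (hg.comp (Continuous.prodMk_right t)).measurable
  have hbound : ∀ K, a * P (A K) ≤ ∫⁻ w, g T w ∂(multivariateGaussian 0 ((T : ℝ) • S)) := fun K => by
    have h := hX.measure_grid_le hgt hsub a (T / 2 ^ K) (2 ^ K)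
    have h1 : ((2 ^ K : ℕ) : ℝ≥0) * (T / 2 ^ K) = T := by
      push_cast
      field_simp
    rwa [h1] at h
  have hsub' : P {ω | ∃ t ≤ T, a < g t (X t ω)} ≤ P (⋃ K, A K) := by
    refine measure_mono_ae ?_
    filter_upwards [hX.cont] with ω hω
    rintro ⟨t, ht, h⟩
    -- The strict inequality is an open condition along a continuous path, hence it persists at a
    -- dyadic time just below `t`.
    have hopen : ∀ᶠ s in nhds t, a < g s (X s ω) :=
      (hg.comp (continuous_id.prodMk hω)).continuousAt.eventually (lt_mem_nhds h)
    have hlim : Filter.Tendsto (fun K : ℕ => (⌊(t : ℝ) / T * 2 ^ K⌋₊ : ℝ≥0) * (T / 2 ^ K))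
        Filter.atTop (nhds t) := by
      rcases eq_or_ne T 0 with rfl | hT
      · rw [le_antisymm ht zero_le]
        simp
      have h1 : Filter.Tendsto (fun K : ℕ => (2 : ℝ) ^ K) Filter.atTop Filter.atTop :=
        tendsto_pow_atTop_atTop_of_one_lt (by norm_num)
      have h2 := ((tendsto_nat_floor_mul_div_atTop (R := ℝ) (a := t / T) (by positivity)).comp
        h1).mul_const (T : ℝ)
      rw [← NNReal.tendsto_coe]
      have hT' : (T : ℝ) ≠ 0 := by exact_mod_cast hT
      rw [div_mul_cancel₀ _ hT'] at h2
      refine h2.congr fun K => ?_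
      simp only [Function.comp_apply]
      push_cast
      ring
    obtain ⟨K, hK⟩ := (hlim.eventually hopen).exists
    refine Set.mem_iUnion.2 ⟨K, _, ?_, hK.le⟩
    refine Nat.floor_le_of_le ?_
    push_cast
    calc (t : ℝ) / T * 2 ^ K ≤ 1 * 2 ^ K := by gcongr; exact div_le_one_of_le₀ ht T.2
      _ = 2 ^ K := one_mul _
  calc _ ≤ a * P (⋃ K, A K) := by gcongr
    _ = ⨆ K, a * P (A K) := by rw [hA.measure_iUnion, ENNReal.mul_iSup]
    _ ≤ _ := iSup_le hbound

/-! ### Exit of one coordinate from the interval. -/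

/-- The law at time `h` of the Brownian motion with covariance `covarianceMatrix m`. -/
noncomputable abbrev bmLaw (m : ℕ) (h : ℝ≥0) : Measure (EuclideanSpace ℝ (Coord m)) :=
  multivariateGaussian 0 ((h : ℝ) • covarianceMatrix m)

theorem measurePreserving_eval_bmLaw (m : ℕ) (h : ℝ≥0) (j : Coord m) :
    MeasurePreserving (fun x : EuclideanSpace ℝ (Coord m) => x j) (bmLaw m h) (gaussianReal 0 h) := by
  have := measurePreserving_eval_multivariateGaussian (μ := 0)
    (smul_covarianceMatrix_posSemidef m h) (i := j)
  simpa [covarianceMatrix_diag] using this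

theorem lintegral_exp_bmLaw (m : ℕ) (h : ℝ≥0) (j : Coord m) (l : ℝ) :
    ∫⁻ w, ENNReal.ofReal (Real.exp (l * w j)) ∂(bmLaw m h) =
      ENNReal.ofReal (Real.exp (h * l ^ 2 / 2)) := by
  rw [(measurePreserving_eval_bmLaw m h j).lintegral_comp
    (f := fun x => ENNReal.ofReal (Real.exp (l * x))) (by fun_prop),
    ← ofReal_integral_eq_lintegral_ofReal (integrable_exp_mul_gaussianReal l)
      (ae_of_all _ fun _ => (Real.exp_pos _).le)]
  have := congrFun (mgf_fun_id_gaussianReal (μ := 0) (v := h)) l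
  rw [mgf] at this
  rw [this, zero_mul, zero_add]

section MaximalInequalities

variable {m : ℕ} {Ω : Type*} [MeasurableSpace Ω] {P : Measure Ω} [IsProbabilityMeasure P]
  {X : ℝ≥0 → Ω → EuclideanSpace ℝ (Coord m)}

/-- Doob's inequality for the submartingale `exp (l X_j)` at level `exp c`, with the Gaussian moment
generating function at time `T`. -/
theorem measure_exists_exp_le (hX : IsBrownianMotion (covarianceMatrix m) X P) (j : Coord m)
    (l c : ℝ) (T : ℝ≥0) :
    P {ω | ∃ t ≤ T, c < l * X t ω j} ≤ ENNReal.ofReal (Real.exp (T * l ^ 2 / 2 - c)) := by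
  have h := hX.measure_exists_lt_le (g := fun _ x => ENNReal.ofReal (Real.exp (l * x j)))
    (ENNReal.continuous_ofReal.comp (by fun_prop)) (fun t h x => ?_) (ENNReal.ofReal (Real.exp c)) T
  · rw [lintegral_exp_bmLaw] at h
    rw [Real.exp_sub, ENNReal.ofReal_div_of_pos (Real.exp_pos _),
      ENNReal.le_div_iff_mul_le (by simp [Real.exp_pos]) (by simp), mul_comm]
    refine le_trans (le_of_eq ?_) h
    congr 2
    ext ω
    simp [ENNReal.ofReal_lt_ofReal_iff, Real.exp_pos]
  · have h1 : ∀ w : EuclideanSpace ℝ (Coord m), ENNReal.ofReal (Real.exp (l * (x + w) j)) =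
        ENNReal.ofReal (Real.exp (l * x j)) * ENNReal.ofReal (Real.exp (l * w j)) := fun w => by
      rw [← ENNReal.ofReal_mul (Real.exp_pos _).le, ← Real.exp_add, PiLp.add_apply, mul_add]
    simp_rw [h1]
    rw [lintegral_const_mul _ (by fun_prop), lintegral_exp_bmLaw]
    refine le_mul_of_one_le_right zero_le ?_
    rw [ENNReal.one_le_ofReal]
    exact Real.one_le_exp (by positivity)

/-- The exit probability of one coordinate from `[-1/2, 1/2]`. -/
theorem measure_exists_half_lt_abs_le (hX : IsBrownianMotion (covarianceMatrix m) X P)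
    (j : Coord m) {T : ℝ≥0} (hT : 0 < T) :
    P {ω | ∃ t ≤ T, 1 / 2 < |X t ω j|} ≤ ENNReal.ofReal (2 * Real.exp (-(1 / (8 * T)))) := by
  -- The slope `l = 1 / (2T)` minimises `T l² / 2 - l / 2`, with minimum `-1 / (8T)`; the level is
  -- `c = l / 2`.
  have hT' : (0 : ℝ) < T := hT
  have h1 := measure_exists_exp_le hX j (1 / (2 * T)) (1 / (4 * T)) T
  have h2 := measure_exists_exp_le hX j (-(1 / (2 * T))) (1 / (4 * T)) T
  have he : T * (1 / (2 * T : ℝ)) ^ 2 / 2 - 1 / (4 * T) = -(1 / (8 * T)) := by field_simp; norm_num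
  have he' : T * (-(1 / (2 * T : ℝ))) ^ 2 / 2 - 1 / (4 * T) = -(1 / (8 * T)) := by
    rw [neg_sq, he]
  rw [he] at h1
  rw [he'] at h2
  rw [two_mul, ENNReal.ofReal_add (Real.exp_pos _).le (Real.exp_pos _).le]
  refine le_trans (measure_mono ?_) ((measure_union_le _ _).trans (add_le_add h1 h2))
  rintro ω ⟨t, ht, h⟩
  have h3 : ∀ y : ℝ, 1 / 2 < y → 1 / (4 * T : ℝ) < 1 / (2 * T) * y := fun y hy => by
    calc (1 / (4 * T) : ℝ) = 1 / (2 * T) * (1 / 2) := by field_simp; norm_num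
      _ < _ := by gcongr
  rcases lt_abs.1 h with h | h
  · exact Or.inl ⟨t, ht, h3 _ h⟩
  · exact Or.inr ⟨t, ht, by have := h3 _ h; linarith⟩

end MaximalInequalities

/-! ### Lower deviations of `|x_t|² / n`. -/

/-- Follows from `log (1 + v) ≥ 2v / (v + 2)`, since `(v - v²/2)(v + 2) = 2v - v³/2`. -/
theorem exp_sub_sq_div_two_le {v : ℝ} (hv : 0 ≤ v) : Real.exp (v - v ^ 2 / 2) ≤ 1 + v := by
  rw [← Real.le_log_iff_exp_le (by linarith)]
  refine le_trans ?_ (Real.le_log_one_add_of_nonneg hv)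
  rw [le_div_iff₀ (by linarith)]
  nlinarith [pow_nonneg hv 3]

/-- For `T > 0` the integral is exactly `e^(cT) (1 + 2cT)^(-1/2)`; the bound is the previous
inequality at `v = 2cT`. -/
theorem lintegral_exp_neg_sq_gaussianReal_le (T : ℝ≥0) {c : ℝ} (hc : 0 ≤ c) :
    ∫⁻ x, ENNReal.ofReal (Real.exp (-(c * (x ^ 2 - T)))) ∂(gaussianReal 0 T) ≤
      ENNReal.ofReal (Real.exp ((c * T) ^ 2)) := by
  rcases eq_or_ne T 0 with rfl | hT
  · simp
  have hT' : (0 : ℝ) < T := by positivity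
  rw [← ofReal_integral_eq_lintegral_ofReal _ (ae_of_all _ fun _ => (Real.exp_pos _).le)]
  · refine ENNReal.ofReal_le_ofReal ?_
    rw [integral_gaussianReal_eq_integral_smul hT]
    have h1 : ∀ x : ℝ, gaussianPDFReal 0 T x • Real.exp (-(c * (x ^ 2 - T))) =
        ((√(2 * Real.pi * T))⁻¹ * Real.exp (c * T)) *
          Real.exp (-((1 + 2 * (c * T)) / (2 * T)) * x ^ 2) := fun x => by
      rw [gaussianPDFReal, smul_eq_mul, mul_assoc _ (Real.exp _), mul_assoc _ (Real.exp _),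
        ← Real.exp_add, ← Real.exp_add]
      congr 2
      field_simp
      ring
    simp_rw [h1]
    rw [integral_const_mul, integral_gaussian, ← Real.sqrt_inv, mul_right_comm,
      ← Real.sqrt_mul (by positivity), mul_comm]
    have h2 : (2 * Real.pi * (T : ℝ))⁻¹ * (Real.pi / ((1 + 2 * (c * T)) / (2 * T))) =
        (1 + 2 * (c * T))⁻¹ := by
      field_simp
    rw [h2, Real.sqrt_inv, ← div_eq_mul_inv, div_le_iff₀ (by positivity),
      ← div_le_iff₀' (Real.exp_pos _), ← Real.exp_sub]
    refine Real.le_sqrt_of_sq_le ?_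
    rw [← Real.exp_nat_mul]
    refine le_trans (le_of_eq ?_) (exp_sub_sq_div_two_le (v := 2 * (c * T)) (by positivity))
    congr 1
    push_cast
    ring
  · refine Integrable.of_bound (C := Real.exp (c * T)) (by fun_prop) (ae_of_all _ fun x => ?_)
    rw [Real.norm_eq_abs, abs_of_pos (Real.exp_pos _), Real.exp_le_exp]
    nlinarith [mul_nonneg hc (sq_nonneg x)]

/-- `|x|² / n` for the first half `x` of a vector of `ℝⁿ × ℝⁿ`. -/
noncomputable def meanSq (m : ℕ) (z : EuclideanSpace ℝ (Coord m)) : ℝ :=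
  1 / (2 : ℝ) ^ m * ∑ a : Idx m, z (Sum.inl a) ^ 2

theorem continuous_meanSq (m : ℕ) : Continuous (meanSq m) := by
  unfold meanSq
  fun_prop

theorem meanSq_nonneg (m : ℕ) (z : EuclideanSpace ℝ (Coord m)) : 0 ≤ meanSq m z := by
  unfold meanSq
  positivity

theorem integral_comp_eval_bmLaw (m : ℕ) (h : ℝ≥0) (j : Coord m) {f : ℝ → ℝ} (hf : Measurable f) :
    ∫ w, f (w j) ∂(bmLaw m h) = ∫ x, f x ∂(gaussianReal 0 h) := by
  have hmp := measurePreserving_eval_bmLaw m h j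
  rw [← hmp.map_eq, integral_map hmp.measurable.aemeasurable hf.aestronglyMeasurable]

theorem integral_eval_bmLaw (m : ℕ) (h : ℝ≥0) (j : Coord m) : ∫ w, w j ∂(bmLaw m h) = 0 := by
  rw [integral_comp_eval_bmLaw m h j (f := fun x => x) measurable_id]
  exact integral_id_gaussianReal

theorem integral_eval_sq_bmLaw (m : ℕ) (h : ℝ≥0) (j : Coord m) :
    ∫ w, w j ^ 2 ∂(bmLaw m h) = h := by
  rw [integral_comp_eval_bmLaw m h j (f := fun x => x ^ 2) (by fun_prop)]
  have h1 := variance_fun_id_gaussianReal (μ := 0) (v := h)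
  rw [variance_eq_integral (by fun_prop)] at h1
  simpa using h1

theorem memLp_eval_bmLaw (m : ℕ) (h : ℝ≥0) (j : Coord m) :
    MemLp (fun w : EuclideanSpace ℝ (Coord m) => w j) 2 (bmLaw m h) :=
  (memLp_id_gaussianReal 2).comp_measurePreserving (measurePreserving_eval_bmLaw m h j)

theorem meanSq_add_sub (m : ℕ) (x w : EuclideanSpace ℝ (Coord m)) :
    meanSq m (x + w) - meanSq m x =
      1 / (2 : ℝ) ^ m * ∑ a : Idx m, (2 * x (Sum.inl a) * w (Sum.inl a) + w (Sum.inl a) ^ 2) := by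
  rw [meanSq, meanSq, ← mul_sub, ← Finset.sum_sub_distrib]
  congr 1
  refine Finset.sum_congr rfl fun a _ => ?_
  rw [PiLp.add_apply]
  ring

theorem integrable_add_sq_bmLaw (m : ℕ) (h : ℝ≥0) (j : Coord m) (c : ℝ) :
    Integrable (fun w => c * w j + w j ^ 2) (bmLaw m h) :=
  (((memLp_eval_bmLaw m h j).integrable (by norm_num)).const_mul _).add
    (memLp_eval_bmLaw m h j).integrable_sq

theorem integral_add_sq_bmLaw (m : ℕ) (h : ℝ≥0) (j : Coord m) (c : ℝ) :
    ∫ w, (c * w j + w j ^ 2) ∂(bmLaw m h) = h := by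
  rw [integral_add (((memLp_eval_bmLaw m h j).integrable (by norm_num)).const_mul _)
    (memLp_eval_bmLaw m h j).integrable_sq, integral_const_mul, integral_eval_bmLaw,
      integral_eval_sq_bmLaw, mul_zero, zero_add]

theorem integrable_meanSq_add_sub (m : ℕ) (h : ℝ≥0) (x : EuclideanSpace ℝ (Coord m)) :
    Integrable (fun w => meanSq m (x + w) - meanSq m x) (bmLaw m h) := by
  simp_rw [meanSq_add_sub]
  exact (integrable_finsetSum _ fun a _ => integrable_add_sq_bmLaw m h _ _).const_mul _

theorem integral_meanSq_add_sub (m : ℕ) (h : ℝ≥0) (x : EuclideanSpace ℝ (Coord m)) :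
    ∫ w, (meanSq m (x + w) - meanSq m x) ∂(bmLaw m h) = h := by
  simp_rw [meanSq_add_sub]
  rw [integral_const_mul, integral_finsetSum _ fun a _ => integrable_add_sq_bmLaw m h _ _,
    Finset.sum_congr rfl fun a _ => integral_add_sq_bmLaw m h _ _, Finset.sum_const,
    Finset.card_univ, nsmul_eq_mul]
  simp

/-- `meanSq - t` is a martingale, and a convex function of it is a submartingale. Jensen's
inequality appears here as `exp u ≥ 1 + u`, the linear term having mean zero. -/
theorem exp_meanSq_le_lintegral (m : ℕ) {c : ℝ} (hc : 0 ≤ c) (t h : ℝ≥0)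
    (x : EuclideanSpace ℝ (Coord m)) :
    ENNReal.ofReal (Real.exp (-(c * (meanSq m x - t)))) ≤
      ∫⁻ w, ENNReal.ofReal (Real.exp (-(c * (meanSq m (x + w) - (t + h : ℝ≥0))))) ∂(bmLaw m h) := by
  have hi := integrable_meanSq_add_sub m h x
  have hI := integral_meanSq_add_sub m h x
  have hcont := continuous_meanSq m
  have hint : Integrable (fun w => Real.exp (-(c * (meanSq m (x + w) - (t + h : ℝ≥0)))))
      (bmLaw m h) := by
    refine Integrable.of_bound (C := Real.exp (c * (t + h : ℝ≥0)))
      (Continuous.aestronglyMeasurable (by fun_prop)) (ae_of_all _ fun w => ?_)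
    rw [Real.norm_eq_abs, abs_of_pos (Real.exp_pos _), Real.exp_le_exp]
    nlinarith [mul_nonneg hc (meanSq_nonneg m (x + w))]
  rw [← ofReal_integral_eq_lintegral_ofReal hint (ae_of_all _ fun _ => (Real.exp_pos _).le)]
  refine ENNReal.ofReal_le_ofReal ?_
  set A := Real.exp (-(c * (meanSq m x - t)))
  calc A = ∫ w, A * (1 + c * h - c * (meanSq m (x + w) - meanSq m x)) ∂(bmLaw m h) := by
        rw [integral_const_mul, integral_sub (integrable_const _) (hi.const_mul _),
          integral_const_mul, hI]
        simp
    _ ≤ _ := by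
        refine integral_mono (((integrable_const _).sub (hi.const_mul _)).const_mul _) hint
          fun w => ?_
        have h1 : Real.exp (-(c * (meanSq m (x + w) - (t + h : ℝ≥0)))) =
            A * Real.exp (c * h - c * (meanSq m (x + w) - meanSq m x)) := by
          rw [← Real.exp_add]
          congr 1
          push_cast
          ring
        simp only [h1]
        refine mul_le_mul_of_nonneg_left ?_ (Real.exp_pos _).le
        linarith [Real.add_one_le_exp (c * h - c * (meanSq m (x + w) - meanSq m x))]

theorem iIndepFun_inl_bmLaw (m : ℕ) (h : ℝ≥0) :
    iIndepFun (fun (a : Idx m) (w : EuclideanSpace ℝ (Coord m)) => w (Sum.inl a)) (bmLaw m h) := by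
  refine HasGaussianLaw.iIndepFun_of_covariance_eq_zero ?_ fun a b hab => ?_
  · have h1 : HasGaussianLaw id (bmLaw m h) := IsGaussian.hasGaussianLaw_id
    exact h1.map_fun (ContinuousLinearMap.pi fun a : Idx m =>
      EuclideanSpace.proj (𝕜 := ℝ) (Sum.inl a : Coord m))
  · rw [covariance_eval_multivariateGaussian (smul_covarianceMatrix_posSemidef m h)]
    simp [covarianceMatrix, hab]

/-- The `n` coordinates of `x` are independent, so the one-dimensional bound with parameter `c / n`
multiplies up to the exponent `n (cT / n)²`. -/
theorem lintegral_exp_meanSq_le (m : ℕ) (T : ℝ≥0) {c : ℝ} (hc : 0 ≤ c) :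
    ∫⁻ w, ENNReal.ofReal (Real.exp (-(c * (meanSq m w - T)))) ∂(bmLaw m T) ≤
      ENNReal.ofReal (Real.exp ((c * T) ^ 2 / 2 ^ m)) := by
  set b : ℝ := c / 2 ^ m with hb
  have h1 : ∀ w : EuclideanSpace ℝ (Coord m),
      ENNReal.ofReal (Real.exp (-(c * (meanSq m w - T)))) =
        ∏ a : Idx m, ENNReal.ofReal (Real.exp (-(b * (w (Sum.inl a) ^ 2 - T)))) := fun w => by
    rw [← ENNReal.ofReal_prod_of_nonneg fun _ _ => (Real.exp_pos _).le, ← Real.exp_sum]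
    congr 2
    rw [Finset.sum_neg_distrib, ← Finset.mul_sum, Finset.sum_sub_distrib, meanSq, hb]
    simp
    field_simp
  simp_rw [h1]
  rw [lintegral_prod_eq_prod_lintegral_of_indepFun Finset.univ
    (fun (a : Idx m) (w : EuclideanSpace ℝ (Coord m)) =>
      ENNReal.ofReal (Real.exp (-(b * (w (Sum.inl a) ^ 2 - T)))))
    ((iIndepFun_inl_bmLaw m T).comp
      (fun _ y => ENNReal.ofReal (Real.exp (-(b * (y ^ 2 - T))))) fun _ => by fun_prop)
    fun _ => by fun_prop]
  have h2 : ∀ a : Idx m, ∫⁻ w, ENNReal.ofReal (Real.exp (-(b * (w (Sum.inl a) ^ 2 - T))))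
      ∂(bmLaw m T) ≤ ENNReal.ofReal (Real.exp ((b * T) ^ 2)) := fun a => by
    rw [(measurePreserving_eval_bmLaw m T (Sum.inl a)).lintegral_comp
      (f := fun y => ENNReal.ofReal (Real.exp (-(b * (y ^ 2 - T))))) (by fun_prop)]
    exact lintegral_exp_neg_sq_gaussianReal_le T (by positivity)
  refine (Finset.prod_le_prod' fun a _ => h2 a).trans (le_of_eq ?_)
  rw [Finset.prod_const, ← ENNReal.ofReal_pow (Real.exp_pos _).le, ← Real.exp_nat_mul]
  congr 2
  simp [hb]
  field_simp

/-- `|x_t|² / n` stays close to `t` from below. -/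
theorem measure_exists_meanSq_lt_le {m : ℕ} {Ω : Type*} [MeasurableSpace Ω] {P : Measure Ω}
    [IsProbabilityMeasure P] {X : ℝ≥0 → Ω → EuclideanSpace ℝ (Coord m)}
    (hX : IsBrownianMotion (covarianceMatrix m) X P) {T : ℝ≥0} (hT : 0 < T) {d : ℝ} (hd : 0 ≤ d) :
    P {ω | ∃ t ≤ T, meanSq m (X t ω) < t - d} ≤
      ENNReal.ofReal (Real.exp (-(d ^ 2 * 2 ^ m / (4 * T ^ 2)))) := by
  have hT' : (0 : ℝ) < T := hT
  rcases hd.eq_or_lt with rfl | hd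
  · simpa using prob_le_one
  -- The minimiser of `(cT)² / n - c d`.
  set c : ℝ := d * 2 ^ m / (2 * T ^ 2)
  have hc : 0 < c := by positivity
  have hcont := continuous_meanSq m
  have h := hX.measure_exists_lt_le
    (g := fun t x => ENNReal.ofReal (Real.exp (-(c * (meanSq m x - t)))))
    (ENNReal.continuous_ofReal.comp (by fun_prop))
    (fun t h x => exp_meanSq_le_lintegral m hc.le t h x) (ENNReal.ofReal (Real.exp (c * d))) T
  replace h := h.trans (lintegral_exp_meanSq_le m T hc.le)
  have he : -(d ^ 2 * 2 ^ m / (4 * (T : ℝ) ^ 2)) = (c * T) ^ 2 / 2 ^ m - c * d := by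
    simp only [c]
    field_simp
    ring
  rw [he, Real.exp_sub, ENNReal.ofReal_div_of_pos (Real.exp_pos _),
    ENNReal.le_div_iff_mul_le (by simp [Real.exp_pos]) (by simp), mul_comm]
  refine le_trans (le_of_eq ?_) h
  congr 2
  ext ω
  simp only [Set.mem_ofPred_eq, ENNReal.ofReal_lt_ofReal_iff, Real.exp_pos, Real.exp_lt_exp]
  refine exists_congr fun t => and_congr_right fun _ => ?_
  rw [← mul_neg, mul_lt_mul_iff_right₀ hc]
  constructor <;> intro h <;> linarith

/-! ### Degeneracy: `y = H x` almost surely. -/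

-- The vector `v = (-H e_b, e_b)` lies in the kernel of the covariance matrix, so the linear form
-- `⟪v, ·⟫` has variance zero and equals its mean, zero.
open scoped RealInnerProductSpace in
theorem inr_eq_hadamard_inl_bmLaw (m : ℕ) (h : ℝ≥0) :
    ∀ᵐ w ∂(bmLaw m h), ∀ b : Idx m, w (Sum.inr b) = (hadamard m *ᵥ fun a => w (Sum.inl a)) b := by
  rw [ae_all_iff]
  intro b
  let v : EuclideanSpace ℝ (Coord m) :=
    WithLp.toLp 2 (Sum.elim (-(hadamard m *ᵥ Pi.single b 1)) (Pi.single b 1))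
  have hv : ∀ w : EuclideanSpace ℝ (Coord m), ⟪v, w⟫ =
      w (Sum.inr b) - (hadamard m *ᵥ fun a => w (Sum.inl a)) b := fun w => by
    have h1 : ⟪v, w⟫ = -((hadamard m *ᵥ Pi.single b 1) ⬝ᵥ fun a => w (Sum.inl a)) +
        Pi.single b 1 ⬝ᵥ fun a => w (Sum.inr a) := by
      simp [v, PiLp.inner_apply, dotProduct, mul_comm]
    rw [h1, hadamard_dotProduct, single_one_dotProduct, single_one_dotProduct]
    ring
  have hmem : MemLp (fun w : EuclideanSpace ℝ (Coord m) => ⟪v, w⟫) 2 (bmLaw m h) :=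
    ((innerSL ℝ v).comp_memLp' (IsGaussian.memLp_two_id (μ := bmLaw m h)))
  have hvar : Var[fun w => ⟪v, w⟫; bmLaw m h] = 0 := by
    rw [← covarianceBilin_self IsGaussian.memLp_two_id,
      covarianceBilin_multivariateGaussian (smul_covarianceMatrix_posSemidef m h)]
    have h1 : covarianceMatrix m *ᵥ v.ofLp = 0 := by
      have e1 : v.ofLp ∘ Sum.inl = -(hadamard m *ᵥ Pi.single b 1) := rfl
      have e2 : v.ofLp ∘ Sum.inr = Pi.single b 1 := rfl
      rw [covarianceMatrix, Matrix.fromBlocks_mulVec, e1, e2, Matrix.one_mulVec, Matrix.one_mulVec,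
        Matrix.mulVec_neg, hadamard_mulVec_mulVec, neg_add_cancel, neg_add_cancel]
      exact Sum.elim_zero_zero
    rw [Matrix.smul_mulVec, h1, smul_zero, dotProduct_zero]
  have hmean : ∫ w, ⟪v, w⟫ ∂(bmLaw m h) = 0 := by
    rw [integral_inner (IsGaussian.integrable_fun_id (μ := bmLaw m h))]
    simp
  filter_upwards [ae_eq_integral_of_variance_eq_zero hmem hvar] with w hw
  rw [hmean, hv] at hw
  linarith

/-! ### The stopping time and measurability of the stopped process. -/

theorem isClosed_box (ι : Type*) [Fintype ι] : IsClosed (box ι) := by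
  have : box ι = ⋂ i, (fun x : EuclideanSpace ℝ ι => x i) ⁻¹' Set.Icc (-1 / 2 : ℝ) (1 / 2) := by
    ext x
    simp only [box, Set.mem_ofPred_eq, Set.mem_iInter, Set.mem_preimage]
  rw [this]
  exact isClosed_iInter fun i => isClosed_Icc.preimage (by fun_prop)

theorem zero_mem_box (ι : Type*) : (0 : EuclideanSpace ℝ ι) ∈ box ι := fun i => by
  simp only [PiLp.zero_apply, Set.mem_Icc]
  norm_num

theorem tendsto_floor_mul_div (t : ℝ≥0) :
    Filter.Tendsto (fun k : ℕ => ((⌊(t : ℝ) * k⌋₊ : ℝ≥0) / k)) Filter.atTop (nhds t) := by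
  rw [← NNReal.tendsto_coe]
  exact (tendsto_nat_floor_mul_div_atTop t.2).comp tendsto_natCast_atTop_atTop

section

variable {ι Ω : Type*} {X : ℝ≥0 → Ω → EuclideanSpace ℝ ι} {e : ℝ≥0}

theorem stopTime_le (ω : Ω) : stopTime e X ω ≤ e := hittingBtwn_le ω

theorem le_stopTime {ω : Ω} {t₀ : ℝ≥0} (ht₀ : t₀ ≤ e)
    (h : ∀ t ≤ t₀, ∀ j, |X t ω j| ≤ 1 / 2) : t₀ ≤ stopTime e X ω := by
  by_contra! hlt
  obtain ⟨t, ht, hX⟩ := (hittingBtwn_lt_iff t₀ ht₀).1 hlt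
  exact hX fun j => by
    have := abs_le.1 (h t ht.2.le j)
    exact ⟨by linarith [this.1], this.2⟩

variable [Fintype ι]

/-- Before the stopping time the path is in the box, which is closed, so by continuity it is still
there at the stopping time. -/
theorem stopped_mem_box {ω : Ω} (h0 : X 0 ω = 0) (hc : Continuous fun t => X t ω) :
    X (stopTime e X ω) ω ∈ box ι := by
  rcases eq_or_ne (stopTime e X ω) 0 with h | h
  · rw [h, h0]
    exact zero_mem_box ι
  have h1 : Set.Iio (stopTime e X ω) ⊆ (fun t => X t ω) ⁻¹' box ι := fun t ht =>
    Set.notMem_compl_iff.1 (notMem_of_lt_hittingBtwn (u := X) (ω := ω) ht zero_le)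
  have h2 := closure_minimal h1 ((isClosed_box ι).preimage hc)
  rw [closure_Iio' ⟨0, pos_iff_ne_zero.2 h⟩] at h2
  exact h2 (Set.mem_Iic.2 le_rfl)

/-- The complement of the box is open, so a continuous path that visits it does so at times of a
countable dense set. This makes the stopping time a countable infimum, hence measurable up to a null
set. -/
theorem stopTime_eq_iInf {ω : Ω} (hc : Continuous fun t => X t ω) :
    stopTime e X ω = ⨅ n, (open scoped Classical in
      if X (TopologicalSpace.denseSeq ℝ≥0 n) ω ∈ (box ι)ᶜ then
        min (TopologicalSpace.denseSeq ℝ≥0 n) e else e) := by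
  classical
  refine le_antisymm (le_ciInf fun n => ?_) (le_of_forall_gt fun i hi => ?_)
  · split_ifs with h
    · rcases le_total (TopologicalSpace.denseSeq ℝ≥0 n) e with h1 | h1
      · rw [min_eq_left h1]
        exact hittingBtwn_le_of_mem zero_le h1 h
      · rw [min_eq_right h1]
        exact stopTime_le ω
    · exact stopTime_le ω
  · rcases lt_or_ge e i with h | h
    · refine lt_of_le_of_lt (ciInf_le (OrderBot.bddBelow _) 0) (lt_of_le_of_lt ?_ h)
      split_ifs
      · exact min_le_right _ _
      · exact le_rfl
    · obtain ⟨j, hj, hX⟩ := (hittingBtwn_lt_iff i h).1 hi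
      have hopen : IsOpen (Set.Iio i ∩ (fun t => X t ω) ⁻¹' (box ι)ᶜ) :=
        isOpen_Iio.inter ((isClosed_box ι).isOpen_compl.preimage hc)
      obtain ⟨_, ⟨h1, h2⟩, n, rfl⟩ := (TopologicalSpace.denseRange_denseSeq ℝ≥0).inter_open_nonempty
        _ hopen ⟨j, hj.2, hX⟩
      refine lt_of_le_of_lt (ciInf_le (OrderBot.bddBelow _) n) ?_
      rw [if_pos (show X (TopologicalSpace.denseSeq ℝ≥0 n) ω ∈ (box ι)ᶜ from h2)]
      exact (min_le_left _ _).trans_lt h1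

variable [MeasurableSpace Ω] {P : Measure Ω}

/-- Each `X t` has a measurable version, but the exceptional null set depends on `t`. Only countably
many times are therefore used: those of the dense sequence, and the discretisations `⌊σ k⌋ / k` of
the stopping time, from which continuity recovers the limit. -/
theorem aemeasurable_stopped (hX : ∀ t, AEMeasurable (X t) P)
    (hc : ∀ᵐ ω ∂P, Continuous fun t => X t ω) :
    AEMeasurable (fun ω => X (stopTime e X ω) ω) P := by
  classical
  let Y : ℝ≥0 → Ω → EuclideanSpace ℝ ι := fun t => (hX t).mk
  have hY : ∀ t, Measurable (Y t) := fun t => (hX t).measurable_mk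
  let q := TopologicalSpace.denseSeq ℝ≥0
  let σ : Ω → ℝ≥0 := fun ω => ⨅ n, if Y (q n) ω ∈ (box ι)ᶜ then min (q n) e else e
  have hσ : Measurable σ := Measurable.iInf fun n => Measurable.ite
    (hY _ (isClosed_box ι).measurableSet.compl) measurable_const measurable_const
  have hσX : ∀ᵐ ω ∂P, stopTime e X ω = σ ω := by
    filter_upwards [hc, ae_all_iff.2 fun n => (hX (q n)).ae_eq_mk] with ω h1 h2
    rw [stopTime_eq_iInf h1]
    refine iInf_congr fun n => ?_
    rw [h2 n]
  refine aemeasurable_of_tendsto_metrizable_ae Filter.atTop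
    (f := fun (k : ℕ) ω => Y ((⌊(σ ω : ℝ) * k⌋₊ : ℝ≥0) / k) ω) (fun k => ?_) ?_
  · have h1 : Measurable fun p : ℕ × Ω => Y ((p.1 : ℝ≥0) / k) p.2 :=
      measurable_from_prod_countable_right fun n => hY ((n : ℝ≥0) / k)
    have h2 : Measurable fun ω => ⌊(σ ω : ℝ) * k⌋₊ :=
      Nat.measurable_floor.comp ((measurable_coe_nnreal_real.comp hσ).mul_const _)
    exact (h1.comp (h2.prodMk measurable_id)).aemeasurable
  · have h3 : ∀ᵐ ω ∂P, ∀ p : ℕ × ℕ, X ((p.1 : ℝ≥0) / p.2) ω = Y ((p.1 : ℝ≥0) / p.2) ω :=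
      ae_all_iff.2 fun p => (hX _).ae_eq_mk
    filter_upwards [hc, hσX, h3] with ω h1 h2 h3
    rw [h2]
    refine ((h1.tendsto _).comp (tendsto_floor_mul_div (σ ω))).congr fun k => ?_
    exact h3 (_, k)

end

section

variable {ι Ω : Type*} [Fintype ι] [DecidableEq ι] [MeasurableSpace Ω] {P : Measure Ω}
  {S : Matrix ι ι ℝ} {X : ℝ≥0 → Ω → EuclideanSpace ℝ ι}

theorem IsBrownianMotion.hasLaw_eval (hX : IsBrownianMotion S X P) (t : ℝ≥0) :
    HasLaw (X t) (multivariateGaussian 0 ((t : ℝ) • S)) P := by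
  have h := hX.law 0 t zero_le
  rw [NNReal.coe_zero, sub_zero] at h
  refine h.congr ?_
  filter_upwards [hX.zero] with ω hω
  rw [hω, sub_zero]

end

/-- Continuity extends the identity from a countable dense set of times to all times outside a
single null set, so it holds at the random stopping time too. -/
theorem IsBrownianMotion.inr_eq_hadamard_inl {m : ℕ} {Ω : Type*} [MeasurableSpace Ω]
    {P : Measure Ω} {X : ℝ≥0 → Ω → EuclideanSpace ℝ (Coord m)}
    (hX : IsBrownianMotion (covarianceMatrix m) X P) :
    ∀ᵐ ω ∂P, ∀ t, (fun b => X t ω (Sum.inr b)) = hadamard m *ᵥ fun a => X t ω (Sum.inl a) := by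
  have h1 : ∀ᵐ ω ∂P, ∀ n, ∀ b, X (TopologicalSpace.denseSeq ℝ≥0 n) ω (Sum.inr b) =
      (hadamard m *ᵥ fun a => X (TopologicalSpace.denseSeq ℝ≥0 n) ω (Sum.inl a)) b :=
    ae_all_iff.2 fun n => ae_of_ae_map (hX.hasLaw_eval (TopologicalSpace.denseSeq ℝ≥0 n)).aemeasurable <| by
      rw [(hX.hasLaw_eval (TopologicalSpace.denseSeq ℝ≥0 n)).map_eq]
      exact inr_eq_hadamard_inl_bmLaw m _
  filter_upwards [hX.cont, h1] with ω hc h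
  refine congrFun (Continuous.ext_on (TopologicalSpace.denseRange_denseSeq ℝ≥0) ?_ ?_ ?_)
  · fun_prop
  · unfold Matrix.mulVec dotProduct
    fun_prop
  · rintro _ ⟨n, rfl⟩
    exact funext (h n)

/-! ### Error probability of one block. -/

/-- `φ` on vectors of `ℝⁿ × ℝⁿ`. -/
noncomputable def phiVec (m : ℕ) (z : Coord m → ℝ) : ℝ :=
  phi m (fun a => z (Sum.inl a)) (fun a => z (Sum.inr a))

theorem phiVec_zero (m : ℕ) : phiVec m 0 = 0 := by
  simp [phiVec, phi, dotProduct]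

theorem forrelation_eq_neg_one {e : ℝ} {m : ℕ} {s : Coord m → ℤˣ}
    (h : e / 2 ≤ phiVec m (signVec s)) : forrelation e s = some (-1) :=
  if_pos h

theorem forrelation_eq_one {e : ℝ} (he : 0 < e) {m : ℕ} {s : Coord m → ℤˣ}
    (h : phiVec m (signVec s) ≤ e / 4) : forrelation e s = some 1 :=
  (if_neg (by change ¬ (e / 2 ≤ phiVec m (signVec s)); linarith)).trans (if_pos h)

theorem measure_rounding_phiVec_le (m : ℕ) {z : Coord m → ℝ}
    (hz : ∀ j, z j ∈ Set.Icc (-1 : ℝ) 1) {d : ℝ} (hd : 0 ≤ d) :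
    (Measure.pi fun j => roundCoord (z j)) {s | d ≤ |phiVec m (signVec s) - phiVec m z|} ≤
      ENNReal.ofReal (4 * Real.exp (-(d ^ 2 * 2 ^ m / 8))) := by
  rw [ENNReal.le_ofReal_iff_toReal_le (by finiteness) (by positivity)]
  exact measureReal_rounding_phi_le m hz hd

/-- A block with no Brownian motion: rounding `0` gives the value `1`. -/
theorem measure_forrelation_zero_le (m : ℕ) {e d : ℝ} (he : 0 < e) (hd : 0 ≤ d) (hde : d ≤ e / 4) :
    (Measure.pi fun _ : Coord m => roundCoord 0) {s | forrelation e s ≠ some 1} ≤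
      ENNReal.ofReal (4 * Real.exp (-(d ^ 2 * 2 ^ m / 8))) := by
  refine le_trans (measure_mono fun s hs => ?_)
    (measure_rounding_phiVec_le m (z := 0) (fun _ => by simp) hd)
  by_contra hlt
  simp only [Set.mem_ofPred_eq, not_le, phiVec_zero, sub_zero] at hlt
  exact hs (forrelation_eq_one he ((le_abs_self _).trans (hlt.le.trans hde)))

section

variable {m : ℕ} {Ω : Type*} [MeasurableSpace Ω] {P : Measure Ω} [IsProbabilityMeasure P]
  {X : ℝ≥0 → Ω → EuclideanSpace ℝ (Coord m)}

/-- If no coordinate exits by time `t₀`, then `τ ≥ t₀`. The lower bound `meanSq ≥ t - d` is uniform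
in `t ≤ e`, so it may be read at `t = τ` without optional stopping. The factor `2 * 2 ^ m` counts
coordinates. -/
theorem measure_stopped_bad_le (hX : IsBrownianMotion (covarianceMatrix m) X P) {e t₀ : ℝ≥0}
    (ht₀ : 0 < t₀) (hte : t₀ ≤ e) {d : ℝ} (hd : 0 ≤ d) :
    P {ω | ¬ (X (stopTime e X ω) ω ∈ box (Coord m) ∧
      t₀ - d ≤ phiVec m (X (stopTime e X ω) ω))} ≤
      ENNReal.ofReal (2 * 2 ^ m * (2 * Real.exp (-(1 / (8 * t₀)))) +
        Real.exp (-(d ^ 2 * 2 ^ m / (4 * e ^ 2)))) := by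
  have he : 0 < e := ht₀.trans_le hte
  have h1 : P (⋃ j, {ω | ∃ t ≤ t₀, 1 / 2 < |X t ω j|}) ≤
      ENNReal.ofReal (2 * 2 ^ m * (2 * Real.exp (-(1 / (8 * t₀))))) := by
    refine (measure_iUnion_le _).trans ?_
    rw [tsum_fintype]
    refine (Finset.sum_le_sum fun j _ => measure_exists_half_lt_abs_le hX j ht₀).trans
      (le_of_eq ?_)
    rw [Finset.sum_const, ← ENNReal.ofReal_nsmul]
    congr 1
    simp
    ring
  have h2 := measure_exists_meanSq_lt_le hX he hd
  rw [ENNReal.ofReal_add (by positivity) (by positivity)]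
  refine le_trans (measure_mono_ae ?_) ((measure_union_le _ _).trans (add_le_add h1 h2))
  filter_upwards [hX.zero, hX.cont, hX.inr_eq_hadamard_inl] with ω h0 hc hH hbad
  by_contra hgood
  refine hbad ⟨stopped_mem_box h0 hc, ?_⟩
  have hg : ¬ ((∃ j, ∃ t ≤ t₀, 1 / 2 < |X t ω j|) ∨ ∃ t ≤ e, meanSq m (X t ω) < t - d) := by
    rintro (⟨j, h⟩ | h)
    · exact hgood (Or.inl (Set.mem_iUnion.2 ⟨j, h⟩))
    · exact hgood (Or.inr h)
  push Not at hg
  have h3 : t₀ ≤ stopTime e X ω := le_stopTime hte fun t ht j => hg.1 j t ht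
  have h4 := hg.2 _ (stopTime_le (e := e) (X := X) ω)
  have h5 : phiVec m (X (stopTime e X ω) ω) = meanSq m (X (stopTime e X ω) ω) := by
    rw [phiVec, hH, phi_hadamard_mulVec, meanSq]
    simp [dotProduct, sq]
  rw [h5]
  have : (t₀ : ℝ) ≤ stopTime e X ω := h3
  linarith

theorem lintegral_le_add_of_le {f : Ω → ℝ≥0∞} (hf : ∀ ω, f ω ≤ 1) {B : Set Ω} {b : ℝ≥0∞}
    (hb : ∀ ω ∉ B, f ω ≤ b) : ∫⁻ ω, f ω ∂P ≤ P B + b := by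
  calc ∫⁻ ω, f ω ∂P ≤ ∫⁻ ω, ((toMeasurable P B).indicator 1 ω + b) ∂P := by
        -- The set `B` need not be measurable, hence its measurable hull.
        refine lintegral_mono fun ω => ?_
        by_cases h : ω ∈ toMeasurable P B
        · rw [Set.indicator_of_mem h]
          exact (hf ω).trans le_self_add
        · rw [Set.indicator_of_notMem h, zero_add]
          exact hb ω fun hB => h (subset_toMeasurable P B hB)
    _ = P B + b := by
        rw [lintegral_add_right _ measurable_const, lintegral_indicator_one
          (measurableSet_toMeasurable P B), measure_toMeasurable, lintegral_const, measure_univ,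
          mul_one]

/-- A block with a Brownian motion: rounding the stopped motion gives the value `-1`. -/
theorem lintegral_forrelation_stopped_le (hX : IsBrownianMotion (covarianceMatrix m) X P)
    {e d : ℝ} (he : 0 < e) (hd : 0 ≤ d) (hde : d ≤ e / 4) :
    ∫⁻ ω, (Measure.pi fun j => roundCoord (X (stopTime e.toNNReal X ω) ω j))
        {s | forrelation e s ≠ some (-1)} ∂P ≤
      ENNReal.ofReal (2 * 2 ^ m * (2 * Real.exp (-(1 / (8 * (e / 2 + 2 * d))))) +
        Real.exp (-(d ^ 2 * 2 ^ m / (4 * e ^ 2))) + 4 * Real.exp (-(d ^ 2 * 2 ^ m / 8))) := by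
  -- Of the margin `2d`, one `d` is lost to the deviation of `meanSq` and one to rounding, leaving
  -- the threshold `e / 2`; `d ≤ e / 4` ensures `t₀ ≤ e`.
  have ht₀ : 0 < e / 2 + 2 * d := by linarith
  have h := measure_stopped_bad_le hX (e := e.toNNReal) (t₀ := (e / 2 + 2 * d).toNNReal)
    (Real.toNNReal_pos.2 ht₀) (Real.toNNReal_le_toNNReal (by linarith)) hd
  rw [Real.coe_toNNReal _ ht₀.le, Real.coe_toNNReal _ he.le] at h
  rw [ENNReal.ofReal_add (by positivity) (by positivity)]
  refine (lintegral_le_add_of_le (fun _ => prob_le_one) fun ω hω => ?_).trans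
    (add_le_add_left h _)
  obtain ⟨hbox, hphi⟩ := not_not.1 hω
  have hz : ∀ j, X (stopTime e.toNNReal X ω) ω j ∈ Set.Icc (-1 : ℝ) 1 := fun j =>
    ⟨by linarith [(hbox j).1], by linarith [(hbox j).2]⟩
  refine le_trans (measure_mono fun s hs => ?_) (measure_rounding_phiVec_le m hz hd)
  by_contra hlt
  simp only [Set.mem_ofPred_eq, not_le] at hlt
  refine hs (forrelation_eq_neg_one ?_)
  have := (abs_lt.1 hlt).1
  linarith

end

/-! ### Choice of parameters. -/

/-- The bound on the probability that one block is rounded to a wrong value of `F`. -/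
noncomputable def blockError (m : ℕ) (e d : ℝ) : ℝ :=
  2 * 2 ^ m * (2 * Real.exp (-(1 / (8 * (e / 2 + 2 * d))))) +
    Real.exp (-(d ^ 2 * 2 ^ m / (4 * e ^ 2))) + 4 * Real.exp (-(d ^ 2 * 2 ^ m / 8))

/-- With `η = 4d / ε` the exit exponent is `7k²L / (1 + η)`, where `L = ln N`. For `k ≥ 2` the
surplus `k²L` pays for both the `N` coordinates and the loss due to `η`. For `k = 1` the `N`
coordinates use it up, and the loss `7ηL` must be bounded by a constant, which is the source of `exp
90000`. -/
theorem exists_blockError_le : ∃ c : ℝ, 0 < c ∧ ∃ C : ℝ, 0 < C ∧ ∀ k m : ℕ, 1 ≤ k →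
    (k : ℝ) ^ 6 * Real.log (blockSize m) ^ 3 ≤ c * (blockSize m : ℝ) →
    0 < eps k m ∧ ∃ d, 0 ≤ d ∧ d ≤ eps k m / 4 ∧
      blockError m (eps k m) d ≤ C * (1 / (blockSize m : ℝ) ^ (6 * k ^ 2)) := by
  refine ⟨1 / 10 ^ 9, by norm_num, 2 * Real.exp 90000 + 5, by positivity, fun k m hk h => ?_⟩
  have hk1 : (1 : ℝ) ≤ k := by exact_mod_cast hk
  have hN : (blockSize m : ℝ) = 2 * 2 ^ m := by simp [blockSize]
  set n : ℝ := 2 ^ m with hn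
  have hn1 : 1 ≤ n := one_le_pow₀ (by norm_num)
  set N : ℝ := (blockSize m : ℝ)
  have hN2 : 2 ≤ N := by linarith
  set L : ℝ := Real.log N with hL
  have hL2 : 1 / 2 < L := by
    have h1 := Real.log_two_gt_d9
    have h2 := Real.log_le_log (by norm_num) hN2
    linarith
  have hexpL : Real.exp L = N := Real.exp_log (by linarith)
  have hkk : 1 ≤ (k : ℝ) ^ 2 := one_le_pow₀ hk1
  have heps : eps k m = 1 / (28 * k ^ 2 * L) := rfl
  have he0 : 0 < eps k m := by rw [heps]; positivity
  have he1 : eps k m ≤ 1 := by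
    rw [heps, div_le_one (by positivity)]
    nlinarith
  set e := eps k m
  have hek : e * (28 * k ^ 2 * L) = 1 := by rw [heps]; field_simp
  -- Chosen so that `exp (-d² n / 8)` is exactly `N^(-6k²)`.
  set d : ℝ := √(48 * k ^ 2 * L / n)
  have hd0 : 0 ≤ d := Real.sqrt_nonneg _
  have hd2 : d ^ 2 = 48 * k ^ 2 * L / n := Real.sq_sqrt (by positivity)
  have hd2n : d ^ 2 * n / 8 = 6 * k ^ 2 * L := by rw [hd2]; field_simp; norm_num
  -- `η = 4 d / ε`
  set η : ℝ := 4 * d * (28 * k ^ 2 * L) with hη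
  have hη0 : 0 ≤ η := by positivity
  have hη2 : η ^ 2 * N = 1204224 * (k ^ 6 * L ^ 3) := by
    rw [hη, mul_pow, mul_pow, hd2, hN]
    field_simp
    norm_num
  have hη3 : η ≤ 1 / 20 := by
    -- `1204224 / 10⁹ < (1/20)²`: this is where the smallness of `c` enters.
    refine abs_le_of_sq_le_sq' ?_ (by norm_num) |>.2
    have : η ^ 2 * N ≤ 1204224 * (1 / 10 ^ 9 * N) := by rw [hη2]; gcongr
    have := le_of_mul_le_mul_right (a := N) (b := η ^ 2) (c := 1204224 * (1 / 10 ^ 9))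
      (by linarith) (by linarith)
    linarith
  have hdη : d = η * e / 4 := by
    rw [hη]
    linear_combination (-d) * hek
  refine ⟨he0, d, hd0, by rw [hdη]; nlinarith, ?_⟩
  have hpow : Real.exp (-(6 * k ^ 2 * L)) = 1 / N ^ (6 * k ^ 2) := by
    rw [Real.exp_neg, ← hexpL, ← Real.exp_nat_mul, one_div]
    push_cast
    rfl
  have h1 : N * Real.exp (-(1 / (8 * (e / 2 + 2 * d)))) ≤
      Real.exp 90000 * Real.exp (-(6 * k ^ 2 * L)) := by
    have h2 : 1 / (8 * (e / 2 + 2 * d)) = 7 * k ^ 2 * L / (1 + η) := by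
      rw [hdη, div_eq_div_iff (by positivity) (by positivity)]
      linear_combination (-(1 + η)) * hek
    have h3 : 7 * k ^ 2 * L * (1 - η) ≤ 7 * k ^ 2 * L / (1 + η) := by
      rw [le_div_iff₀ (by linarith), mul_assoc]
      refine mul_le_of_le_one_right (by positivity) ?_
      nlinarith [sq_nonneg η]
    rw [h2, ← hexpL, ← Real.exp_add, ← Real.exp_add, Real.exp_le_exp]
    suffices L * (1 - k ^ 2 + 7 * k ^ 2 * η) ≤ 90000 by linarith
    rcases hk.eq_or_lt with rfl | hk2
    -- `(ηL)² N = 1204224 L⁵` and `L⁵ ≤ 5! N`; then `7 · 12200 ≤ 90000`.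
    · have h4 : (η * L) ^ 2 ≤ 12200 ^ 2 := by
        have h5 := Real.pow_div_factorial_le_exp L (by linarith) 5
        rw [hexpL, div_le_iff₀ (by positivity)] at h5
        have h6 : (η * L) ^ 2 * N ≤ 1204224 * 120 * N := by
          calc (η * L) ^ 2 * N = (η ^ 2 * N) * L ^ 2 := by ring
            _ = 1204224 * L ^ 5 := by rw [hη2]; push_cast; ring
            _ ≤ 1204224 * (N * (Nat.factorial 5 : ℕ)) := by gcongr
            _ = _ := by simp [Nat.factorial]; ring
        have := le_of_mul_le_mul_right h6 (by linarith)
        linarith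
      have h5 := abs_le_of_sq_le_sq' h4 (by norm_num) |>.2
      calc L * (1 - ((1 : ℕ) : ℝ) ^ 2 + 7 * ((1 : ℕ) : ℝ) ^ 2 * η) = 7 * (η * L) := by
            push_cast
            ring
        _ ≤ 90000 := by linarith
    · have hk2' : (2 : ℝ) ≤ k := by exact_mod_cast hk2
      have h4 : (1 : ℝ) - k ^ 2 + 7 * k ^ 2 * η ≤ 0 := by
        have h5 : 7 * (k : ℝ) ^ 2 * η ≤ 7 * (k : ℝ) ^ 2 * (1 / 20) := by gcongr
        have h6 : (2 : ℝ) ^ 2 ≤ k ^ 2 := by gcongr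
        linarith
      exact (mul_nonpos_of_nonneg_of_nonpos (by linarith) h4).trans (by norm_num)
  -- As `e ≤ 1`, the denominator `4e²` is at most `8`, so this term is dominated by the rounding
  -- exponent.
  have h2 : Real.exp (-(d ^ 2 * n / (4 * e ^ 2))) ≤ Real.exp (-(6 * k ^ 2 * L)) := by
    rw [Real.exp_le_exp, neg_le_neg_iff, ← hd2n]
    exact div_le_div_of_nonneg_left (by positivity) (by positivity) (by nlinarith)
  rw [← hpow, blockError, hd2n, ← hN]
  linarith

theorem exp_le_blockError (m : ℕ) (e d : ℝ) :
    4 * Real.exp (-(d ^ 2 * 2 ^ m / 8)) ≤ blockError m e d := by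
  unfold blockError
  have : 0 ≤ 2 * (2 : ℝ) ^ m * (2 * Real.exp (-(1 / (8 * (e / 2 + 2 * d))))) +
    Real.exp (-(d ^ 2 * 2 ^ m / (4 * e ^ 2))) := by positivity
  linarith

/-! ### Union bound over blocks and mixture over subsets. -/

theorem xorForrelation_eq {k m : ℕ} {z : Fin k → Coord m → ℤˣ} {S : Finset (Fin k)}
    (h : ∀ i, forrelation (eps k m) (z i) = some (if i ∈ S then -1 else 1)) :
    xorForrelation z = some ((-1) ^ S.card) := by
  rw [xorForrelation, if_pos fun i => by rw [h i]; rfl]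
  congr 1
  simp_rw [h, Option.getD_some]
  rw [Finset.prod_ite_mem, Finset.univ_inter, Finset.prod_const]

instance isMarkovKernel_rounding (k m : ℕ) : IsMarkovKernel (rounding k m) where
  isProbabilityMeasure z := by
    change IsProbabilityMeasure (Measure.pi fun i => Measure.pi fun j => roundCoord (z i j))
    infer_instance

theorem rounding_preimage_eval (k m : ℕ) (z : Fin k → EuclideanSpace ℝ (Coord m)) (i : Fin k)
    (B : Set (Coord m → ℤˣ)) :
    rounding k m z {s | s i ∈ B} = (Measure.pi fun j => roundCoord (z i j)) B :=
  (measurePreserving_eval (fun i => Measure.pi fun j => roundCoord (z i j)) i).measure_preimage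
    (Set.toFinite B).measurableSet.nullMeasurableSet

section

variable {k m : ℕ} {Ω : Type*} [MeasurableSpace Ω] {P : Measure Ω}
  {X : Fin k → ℝ≥0 → Ω → EuclideanSpace ℝ (Coord m)}

theorem aemeasurable_blocks (hX : ∀ i, IsBrownianMotion (covarianceMatrix m) (X i) P)
    (S : Finset (Fin k)) :
    AEMeasurable (fun ω i => if i ∈ S then X i (stopTime (eps k m).toNNReal (X i) ω) ω else 0) P :=
  aemeasurable_pi_lambda _ fun i => by
    by_cases h : i ∈ S
    · simp only [h, if_true]
      exact aemeasurable_stopped (fun t => ((hX i).hasLaw_eval t).aemeasurable) (hX i).cont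
    · simp only [h, if_false]
      exact aemeasurable_const

variable [IsProbabilityMeasure P]

/-- A wrong or undefined product forces some block to miss its sign (`-1` on `S`, `1` off `S`); the
union bound sums the one-block errors. -/
theorem lintegral_rounding_distOn_le (hX : ∀ i, IsBrownianMotion (covarianceMatrix m) (X i) P)
    (S : Finset (Fin k)) (he : 0 < eps k m) {d : ℝ} (hd : 0 ≤ d) (hde : d ≤ eps k m / 4) :
    ∫⁻ z, rounding k m z {s | xorForrelation s ≠ some ((-1) ^ S.card)} ∂(distOn P X S) ≤
      ENNReal.ofReal (k * blockError m (eps k m) d) := by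
  let B : Fin k → Set (Coord m → ℤˣ) := fun i =>
    {s | forrelation (eps k m) s ≠ some (if i ∈ S then -1 else 1)}
  have hsub : {s : Fin k → Coord m → ℤˣ | xorForrelation s ≠ some ((-1) ^ S.card)} ⊆
      ⋃ i, {s | s i ∈ B i} := fun s hs => by
    by_contra hcon
    simp only [Set.mem_iUnion, not_exists, Set.mem_ofPred_eq, B, not_not] at hcon
    exact hs (xorForrelation_eq hcon)
  have hmeas : ∀ C : Set (Fin k → Coord m → ℤˣ), Measurable fun z => rounding k m z C :=
    fun C => (rounding k m).measurable_coe (Set.toFinite C).measurableSet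
  have hB : ∀ i, ∫⁻ z, rounding k m z {s | s i ∈ B i} ∂(distOn P X S) ≤
      ENNReal.ofReal (blockError m (eps k m) d) := fun i => by
    rw [distOn, lintegral_map' (hmeas _).aemeasurable (aemeasurable_blocks hX S)]
    simp_rw [rounding_preimage_eval]
    by_cases h : i ∈ S
    · simp only [B, h, if_true]
      exact lintegral_forrelation_stopped_le (hX i) he hd hde
    · simp only [B, h, if_false, PiLp.zero_apply]
      rw [lintegral_const, measure_univ, mul_one]
      exact (measure_forrelation_zero_le m he hd hde).trans
        (ENNReal.ofReal_le_ofReal (exp_le_blockError m _ d))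
  calc _ ≤ ∫⁻ z, ∑ i, rounding k m z {s | s i ∈ B i} ∂(distOn P X S) :=
        lintegral_mono fun z => (measure_mono hsub).trans <|
          (measure_iUnion_le _).trans_eq (tsum_fintype _)
    _ = ∑ i, ∫⁻ z, rounding k m z {s | s i ∈ B i} ∂(distOn P X S) :=
        lintegral_finsetSum _ fun i _ => hmeas _
    _ ≤ ∑ _i : Fin k, ENNReal.ofReal (blockError m (eps k m) d) :=
        Finset.sum_le_sum fun i _ => hB i
    _ = _ := by
        rw [Finset.sum_const, Finset.card_univ, Fintype.card_fin, ← ENNReal.ofReal_nsmul,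
          nsmul_eq_mul]

theorem isProbabilityMeasure_mixture (hX : ∀ i, IsBrownianMotion (covarianceMatrix m) (X i) P)
    {A : Finset (Finset (Fin k))} (hA : A.Nonempty) : IsProbabilityMeasure (mixture P X A) where
  measure_univ := by
    have h : ∀ S ∈ A, distOn P X S Set.univ = 1 := fun S _ =>
      (Measure.isProbabilityMeasure_map (aemeasurable_blocks hX S)).measure_univ
    rw [mixture, Measure.smul_apply, Measure.finsetSum_apply, Finset.sum_congr rfl h]
    simp only [Finset.sum_const, nsmul_eq_mul, mul_one, smul_eq_mul]
    exact ENNReal.inv_mul_cancel (by simpa using hA.ne_empty) (by simp)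

/-- All members of `A` have the same parity, hence the same target sign `u`, and the error bound
does not depend on `S`, so averaging preserves it. -/
theorem one_sub_le_mixture_bind (hX : ∀ i, IsBrownianMotion (covarianceMatrix m) (X i) P)
    {A : Finset (Finset (Fin k))} (hA : A.Nonempty) {u : ℤˣ} (hu : ∀ S ∈ A, (-1) ^ S.card = u)
    (he : 0 < eps k m) {d : ℝ} (hd : 0 ≤ d) (hde : d ≤ eps k m / 4) :
    1 - k * blockError m (eps k m) d ≤
      ((mixture P X A).bind (rounding k m)).real {z | xorForrelation z = some u} := by
  have := isProbabilityMeasure_mixture hX hA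
  have hG : MeasurableSet {z : Fin k → Coord m → ℤˣ | xorForrelation z = some u} :=
    (Set.toFinite _).measurableSet
  have hE : 0 ≤ blockError m (eps k m) d := le_trans (by positivity) (exp_le_blockError m _ d)
  suffices h : ((mixture P X A).bind (rounding k m)).real {z | xorForrelation z = some u}ᶜ ≤
      k * blockError m (eps k m) d by
    rw [probReal_compl_eq_one_sub hG] at h
    linarith
  rw [Measure.real, ← ENNReal.le_ofReal_iff_toReal_le (by finiteness) (by positivity),
    Measure.bind_apply hG.compl (rounding k m).aemeasurable, mixture, lintegral_smul_measure,
    lintegral_finsetSum_measure]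
  calc _ ≤ (A.card : ℝ≥0∞)⁻¹ • ∑ _S ∈ A, ENNReal.ofReal (k * blockError m (eps k m) d) := by
        gcongr with S hS
        have h := lintegral_rounding_distOn_le hX S he hd hde
        rw [hu S hS] at h
        exact h
    _ = _ := by
        rw [Finset.sum_const, nsmul_eq_mul, smul_eq_mul, ← mul_assoc,
          ENNReal.inv_mul_cancel (by simpa using hA.ne_empty) (by simp), one_mul]

end

end Forrelation

theorem mainTheorem3 :
    ∃ c : ℝ, 0 < c ∧ ∃ C : ℝ, 0 < C ∧ ∀ k m : ℕ, 1 ≤ k →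
      (k : ℝ) ^ 6 * Real.log (Forrelation.blockSize m) ^ 3 ≤ c * (Forrelation.blockSize m : ℝ) →
      ∀ {Ω : Type*} [MeasurableSpace Ω] (P : Measure Ω) [IsProbabilityMeasure P]
        (X : Fin k → ℝ≥0 → Ω → EuclideanSpace ℝ (Forrelation.Coord m)),
        (∀ i, Forrelation.IsBrownianMotion (Forrelation.covarianceMatrix m) (X i) P) →
        iIndepFun (fun i ω t => X i t ω) P →
        1 - C * ((k : ℝ) / (Forrelation.blockSize m : ℝ) ^ (6 * k ^ 2)) ≤
            (Forrelation.roundedEven P X).real {z | Forrelation.xorForrelation z = some 1} ∧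
        1 - C * ((k : ℝ) / (Forrelation.blockSize m : ℝ) ^ (6 * k ^ 2)) ≤
            (Forrelation.roundedOdd P X).real {z | Forrelation.xorForrelation z = some (-1)} := by
  obtain ⟨c, hc, C, hC, h⟩ := Forrelation.exists_blockError_le
  refine ⟨c, hc, C, hC, fun k m hk hkN Ω _ P _ X hX _ => ?_⟩
  obtain ⟨he, d, hd, hde, hE⟩ := h k m hk hkN
  have hle : 1 - C * ((k : ℝ) / (Forrelation.blockSize m : ℝ) ^ (6 * k ^ 2)) ≤
      1 - k * Forrelation.blockError m (Forrelation.eps k m) d := by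
    have := mul_le_mul_of_nonneg_left hE (Nat.cast_nonneg (α := ℝ) k)
    have h2 : (k : ℝ) * (C * (1 / (Forrelation.blockSize m : ℝ) ^ (6 * k ^ 2))) =
      C * ((k : ℝ) / (Forrelation.blockSize m : ℝ) ^ (6 * k ^ 2)) := by ring
    linarith
  constructor
  · refine hle.trans (Forrelation.one_sub_le_mixture_bind hX ⟨∅, by simp⟩ (fun S hS => ?_) he hd hde)
    exact (Finset.mem_filter.1 hS).2.neg_one_pow
  -- A set of odd size exists because `k ≥ 1`.
  · refine hle.trans (Forrelation.one_sub_le_mixture_bind hX ⟨{⟨0, hk⟩}, by simp⟩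
      (fun S hS => ?_) he hd hde)
    exact (Finset.mem_filter.1 hS).2.neg_one_pow
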